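/- Let $X$ be the Euclidean plane $\mathbb{R}^2$ or the hyperbolic plane $\mathbb{H}^2$, and let $\mathcal{S}=X/\Gamma$ be, respectively, a flat torus ($\Gamma$ generated by two linearly independent translations) or a closed oriented hyperbolic surface ($\Gamma$ a discrete subgroup of $PSL(2,\mathbb{R})$ acting freely on $\mathbb{H}^2$ with compact quotient), with universal covering $\rho\colon X\to\mathcal{S}$. A \emph{geometric triangulation} of $\mathcal{S}$ with finite vertex set $V\subset\mathcal{S}$ is a triangulation whose edges are realized by interior-disjoint locally geodesic segments (loops and multiple edges are allowed); that is, $\mathcal{S}$ is partitioned into the points of $V$, finitely many open edges and finitely many open faces, whose lifts to $X$ are open geodesic segments and open non-degenerate geodesic triangles. Combinatorially, a triangulation is given by the $\Gamma$-invariant family of the vertex triples of the lifts of its faces, each edge being taken up to homotopy with fixed endpoints. Circles of $\mathbb{H}^2$ are the traces, in the Poincaré model, of Euclidean circles and lines (they may be non-compact). The \emph{disk inscribing} a geodesic triangle that is non-degenerate (its vertices do not lie on a common geodesic) is the open region bounded by the circle through its three vertices that contains the open triangle. Let $T$ be a geometric triangulation of $\mathcal{S}$ with vertex set $V$, and let $e$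 be an edge of $T$. Let $\tilde t_1=(\tilde v_1,\tilde v_2,\tilde v_3)$ and $\tilde t_2=(\tilde v_2,\tilde v_1,\tilde v_4)$ be two distinct adjacent lifted triangles sharing a lift $\tilde e=(\tilde v_1,\tilde v_2)$ of $e$. \emph{Flipping} $e$ replaces on $\mathcal{S}$ the two projected triangles by the projections of $(\tilde v_3,\tilde v_4,\tilde v_2)$ and $(\tilde v_4,\tilde v_3,\tilde v_1)$. The flip is \emph{Delaunay} if these two new triangles are non-degenerate, the disk inscribing $(\tilde v_3,\tilde v_4,\tilde v_2)$ does not contain $\tilde v_1$, and the disk inscribing $(\tilde v_4,\tilde v_3,\tilde v_1)$ does not contain $\tilde v_2$. \textbf{Lemma.} If the flip of $e$ is Delaunay, then the triangulation $T'$ obtained from $T$ by flipping $e$ is again a geometric triangulation of $\mathcal{S}$ with vertex set $V$. Moreover, the quadrilateral $\tilde t_1\cup\tilde t_2$ is strictly convex. -/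

import Mathlib

open scoped MatrixGroups UpperHalfPlane

namespace GeomTri

section Planes

/-- A geometry on a plane in which circles are visible: the model sits inside `ℂ`, and its (possibly
non-compact) circles are the traces of the Euclidean circles and lines of `ℂ`. -/
class PlaneModel (X : Type) where
  toComplex : X → ℂ

/-- The Euclidean plane, as `ℂ` with its Euclidean metric. -/
instance euclideanPlane : PlaneModel ℂ where
  toComplex := fun z => z

/-- The hyperbolic plane, in the conformal half-plane model with Mathlib's hyperbolic metric. -/
instance hyperbolicPlane : PlaneModel ℍ where
  toComplex := fun z => (z : ℂ)

variable {X : Type} [MetricSpace X]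

/-- The geodesic segment `[x, y]`. In the Euclidean and in the hyperbolic plane it consists exactly
of the points lying metrically between `x` and `y`. -/
def geodSegment (x y : X) : Set X :=
  {z | dist x z + dist z y = dist x y}

/-- Convexity with respect to geodesic segments. -/
def GeodConvex (s : Set X) : Prop :=
  ∀ ⦃x⦄, x ∈ s → ∀ ⦃y⦄, y ∈ s → geodSegment x y ⊆ s

/-- The geodesic convex hull: a point, a geodesic segment, a geodesic triangle when `s` consists of
one, two, three points. -/
def geodHull (s : Set X) : Set X :=
  ⋂₀ {c | s ⊆ c ∧ GeodConvex c}

/-- The open cell with vertex set `s`: the geodesic hull without its boundary faces, that is, the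
point, the open geodesic segment, the open geodesic triangle when `s` is a set of one, two,
three points (not on a common geodesic). -/
def openCell (s : Set X) : Set X :=
  geodHull s \ ⋃ r ∈ {r : Set X | r ⊂ s}, geodHull r

/-- `p, q, r` do not lie on a common geodesic: none lies between the other two (in particular
they are distinct). -/
def NonCollinear (p q r : X) : Prop :=
  p ∉ geodSegment q r ∧ q ∉ geodSegment r p ∧ r ∉ geodSegment p q

/-- `D` is the open disk inscribing the (non-degenerate) geodesic triangle `p q r`: the circle
through `p, q, r` is the trace on the model of a Euclidean circle or line, with equation
`α |z|² + β Re z + γ Im z + δ = 0`, and `D` is the side of it that contains the triangle. -/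
def IsInscribingDisk [PlaneModel X] (D : Set X) (p q r : X) : Prop :=
  NonCollinear p q r ∧
  ∃ α β γ δ : ℝ, ∃ f : X → ℝ,
    (∀ x, f x = α * Complex.normSq (PlaneModel.toComplex x) + β * (PlaneModel.toComplex x).re
        + γ * (PlaneModel.toComplex x).im + δ) ∧
    f p = 0 ∧ f q = 0 ∧ f r = 0 ∧
    D = {x | f x < 0} ∧
    openCell {p, q, r} ⊆ D

/-- The quadrilateral made of the two triangles `a b c` and `a b d` glued along the diagonal `a b`
is strictly convex: it is convex, and each of its four vertices is a true corner. -/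
def StrictlyConvexQuad (a b c d : X) : Prop :=
  GeodConvex (geodHull {a, b, c} ∪ geodHull {a, b, d}) ∧
  a ∉ geodHull {b, c, d} ∧ b ∉ geodHull {a, c, d} ∧
  c ∉ geodHull {a, b, d} ∧ d ∉ geodHull {a, b, c}

end Planes

section Surfaces

/-- The surface `X / Γ` with universal cover `X`, for a group `Γ` of transformations of `X`. -/
abbrev Surface {X : Type} (Γ : Subgroup (Equiv.Perm X)) : Type :=
  MulAction.orbitRel.Quotient Γ X

/-- The covering projection. -/
def proj {X : Type} (Γ : Subgroup (Equiv.Perm X)) (x : X) : Surface Γ :=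
  Quotient.mk _ x

/-- `ℂ / Γ` is a flat torus: `Γ` is generated by two independent translations. -/
def IsFlatTorus (Γ : Subgroup (Equiv.Perm ℂ)) : Prop :=
  ∃ u v : ℂ, LinearIndependent ℝ ![u, v] ∧
    Γ = Subgroup.closure {Equiv.addRight u, Equiv.addRight v}

/-- `ℍ / Γ` is a closed oriented hyperbolic surface: `Γ` is a discrete subgroup of `PSL(2, ℝ)`,
realised as the group of Möbius transformations of `ℍ`, acting freely and with compact quotient. -/
structure IsClosedHyperbolicSurface (Γ : Subgroup (Equiv.Perm ℍ)) : Prop where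
  orientation_preserving_isometries : Γ ≤ (MulAction.toPermHom SL(2, ℝ) ℍ).range
  discrete : ProperlyDiscontinuousSMul Γ ℍ
  free : ∀ g ∈ Γ, (∃ x, g x = x) → g = 1
  compact : CompactSpace (Surface Γ)

end Surfaces

section Triangulations

variable {X : Type} [MetricSpace X]

/-- The simplices of a family of triangles, given by their vertex sets: the vertices, the edges
and the triangles. -/
def simplices (F : Set (Set X)) : Set (Set X) :=
  {s | s.Nonempty ∧ ∃ t ∈ F, s ⊆ t}

/-- `F` is (the set of vertex sets of triangles of the inverse image in `X` of) a geometric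
triangulation of the surface `X / Γ` with finite vertex set `V`.

On the surface, the faces, edges and vertices of the triangulation are the projections of open
geodesic triangles, open geodesic segments and points of `X`, they are finitely many, and they
partition the surface. Loops and multiple edges are allowed on the surface. -/
structure IsGeometricTriangulation (Γ : Subgroup (Equiv.Perm X)) (V : Set (Surface Γ))
    (F : Set (Set X)) : Prop where
  finite_vertices : V.Finite
  /-- the inverse image of the vertex set is the set of vertices of the lifted triangles -/
  vertices : proj Γ ⁻¹' V = ⋃₀ F
  triangle : ∀ t ∈ F, ∃ p q r, NonCollinear p q r ∧ t = {p, q, r}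
  invariant : ∀ g ∈ Γ, ∀ t ∈ F, g '' t ∈ F
  /-- finitely many triangles on the surface -/
  finite_faces : ∃ F₀ ⊆ F, F₀.Finite ∧ ∀ t ∈ F, ∃ g ∈ Γ, ∃ s ∈ F₀, t = g '' s
  /-- the open cells partition the plane (hence, by invariance, the surface) -/
  partition : ∀ x, ∃! s, s ∈ simplices F ∧ x ∈ openCell s

/-- The result of flipping the edge `a b`, shared by the lifted triangles `a b c` and `b a d`: on the
surface, hence simultaneously in all translates under `Γ` upstairs, these two triangles are replaced
by the triangles `c d b` and `d c a`. -/
def flip (Γ : Subgroup (Equiv.Perm X)) (F : Set (Set X)) (a b c d : X) : Set (Set X) :=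
  {t ∈ F | ∀ g ∈ Γ, t ≠ g '' {a, b, c} ∧ t ≠ g '' {b, a, d}} ∪
  {t | ∃ g ∈ Γ, t = g '' {c, d, b} ∨ t = g '' {d, c, a}}

/-- The lifted edge `a b` of `F` is shared by the two distinct triangles `a b c` and `b a d`, and is
Delaunay flippable: after the flip, the quadrilateral is locally Delaunay, i.e. the (open) disk
inscribing `c d b` does not contain `a`, and the one inscribing `d c a` does not contain `b`. -/
structure IsDelaunayFlippable [PlaneModel X] (F : Set (Set X)) (a b c d : X) : Prop where
  mem_left : {a, b, c} ∈ F
  mem_right : {b, a, d} ∈ F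
  ne : c ≠ d
  disk_left : ∃ D, IsInscribingDisk D c d b ∧ a ∉ D
  disk_right : ∃ D, IsInscribingDisk D d c a ∧ b ∉ D

end Triangulations

end GeomTri

/-! In a chart where geodesics are straight, the statement becomes affine geometry of four points.
For the Euclidean plane the chart is the identity. For the hyperbolic plane it is `projectiveChart`,
x + iy ↦ (x, x² + y²), a projective model whose image is the convex region above a parabola
(`isStraightChart_projectiveChart`).

Strict convexity. The vertices c and d lie on opposite sides of ab, since otherwise the two
triangles would overlap, against the partition into open cells. Of the Delaunay condition one
consequence suffices: a disk contains the open triangle it inscribes, so a is not inside the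
triangle cdb and b is not inside dca. The linear relation between a, b, c, d whose coefficients are
signed areas then leaves only the sign pattern in which the diagonals ab and cd cross
(`crossing_of_pos_of_neg`).

Triangulation. When the diagonals cross, the open cells on either side of ab together with ab cover
the same points as those obtained from cd (`Crossing.exchange`), so the partition persists inside
the quadrilateral. To exchange the cells in all translates at once, distinct elements of Γ must
carry these cells to distinct sets (`IsFlippable.eq_one_of_image_eq`). This holds because no
nontrivial element fixes a point, nor does its square or its cube, and because orientation is
preserved. Finally ab is an edge of the two given triangles only (`IsFlippable.eq_or_eq_of_subset`),
so all other cells survive unchanged. -/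

namespace GeomTri

/-- The open cells of the quadrilateral made of the triangles `a b c` and `b a d`, given by their
vertex sets. -/
def quadCells {α : Type*} (a b c d : α) : Set (Set α) :=
  {{a, b, c}, {b, a, d}, {a, b}}

lemma image_quadCells {α β : Type*} (f : α → β) (a b c d : α) :
    (fun s => f '' s) '' quadCells a b c d = quadCells (f a) (f b) (f c) (f d) := by
  simp [quadCells, Set.image_insert_eq]

/-! ### Signed areas, barycentric coordinates and open simplices in the affine plane. -/

section Planar

/-- Twice the signed area of the triangle `p q r`. -/
def cross (p q r : ℂ) : ℝ :=
  (q.re - p.re) * (r.im - p.im) - (q.im - p.im) * (r.re - p.re)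

lemma cross_rotate (p q r : ℂ) : cross q r p = cross p q r := by
  simp only [cross]; ring

lemma cross_swap (p q r : ℂ) : cross q p r = -cross p q r := by
  simp only [cross]; ring

lemma cross_combo {u v w : ℝ} (h : u + v + w = 1) (x y p q r : ℂ) :
    cross x y (u • p + v • q + w • r) = u * cross x y p + v * cross x y q + w * cross x y r := by
  obtain rfl : u = 1 - v - w := by linarith
  simp [cross]; ring

lemma cross_combo_pair {u v : ℝ} (h : u + v = 1) (x y p q : ℂ) :
    cross x y (u • p + v • q) = u * cross x y p + v * cross x y q := by
  obtain rfl : u = 1 - v := by linarith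
  simp [cross]; ring

lemma cross_left (p q : ℂ) : cross p q p = 0 := by simp [cross]

lemma cross_right (p q : ℂ) : cross p q q = 0 := by simp [cross]; ring

/-- Cramer's rule: the signed areas of the three subtriangles at z are its unnormalised barycentric
coordinates. -/
lemma cross_smul_eq (p q r z : ℂ) :
    cross p q r • z = cross q r z • p + cross r p z • q + cross p q z • r := by
  apply Complex.ext <;> simp [cross] <;> ring

lemma cross_add_eq (p q r z : ℂ) :
    cross q r z + cross r p z + cross p q z = cross p q r := by
  simp only [cross]; ring

/-- Barycentric coordinates. -/
lemma exists_weights {p q r : ℂ} (h : cross p q r ≠ 0) (z : ℂ) :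
    z = (cross q r z / cross p q r) • p + (cross r p z / cross p q r) • q
        + (cross p q z / cross p q r) • r ∧
      cross q r z / cross p q r + cross r p z / cross p q r + cross p q z / cross p q r = 1 := by
  constructor
  · have := congrArg (fun y => (cross p q r)⁻¹ • y) (cross_smul_eq p q r z)
    simp only [smul_add, smul_smul, inv_mul_cancel₀ h, one_smul] at this
    simpa only [div_eq_inv_mul] using this
  · rw [← add_div, ← add_div, cross_add_eq, div_self h]

lemma mem_convexHull_triple {p q r z : ℂ} :
    z ∈ convexHull ℝ {p, q, r} ↔ ∃ u v w : ℝ, 0 ≤ u ∧ 0 ≤ v ∧ 0 ≤ w ∧ u + v + w = 1 ∧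
      z = u • p + v • q + w • r := by
  constructor
  · rw [convexHull_insert (by simp), convexHull_pair, mem_convexJoin]
    rintro ⟨p', hp, y, ⟨s, t, hs, ht, hst, rfl⟩, ⟨u, v, hu, hv, huv, rfl⟩⟩
    rw [Set.mem_singleton_iff] at hp
    subst hp
    refine ⟨u, v * s, v * t, hu, by positivity, by positivity, ?_, by module⟩
    linear_combination huv + v * hst
  · rintro ⟨u, v, w, hu, hv, hw, h, rfl⟩
    have hc := convex_convexHull ℝ ({p, q, r} : Set ℂ)
    have hs := subset_convexHull ℝ ({p, q, r} : Set ℂ)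
    have := hc.sum_mem (t := Finset.univ) (w := ![u, v, w]) (z := ![p, q, r])
      (by intro i _; fin_cases i <;> simpa) (by simpa [Fin.sum_univ_three] using h)
      (by intro i _; fin_cases i <;> exact hs (by simp))
    simpa [Fin.sum_univ_three] using this

lemma mem_convexHull_pair {p q z : ℂ} :
    z ∈ convexHull ℝ {p, q} ↔ ∃ u v : ℝ, 0 ≤ u ∧ 0 ≤ v ∧ u + v = 1 ∧ z = u • p + v • q := by
  rw [convexHull_pair]
  constructor
  · rintro ⟨u, v, hu, hv, h, rfl⟩; exact ⟨u, v, hu, hv, h, rfl⟩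
  · rintro ⟨u, v, hu, hv, h, rfl⟩; exact ⟨u, v, hu, hv, h, rfl⟩

/-- The convex hull without the hulls of the proper subsets. -/
def relInt (s : Set ℂ) : Set ℂ :=
  convexHull ℝ s \ ⋃ r ∈ {r : Set ℂ | r ⊂ s}, convexHull ℝ r

lemma mem_relInt {s : Set ℂ} {z : ℂ} :
    z ∈ relInt s ↔ z ∈ convexHull ℝ s ∧ ∀ r, r ⊂ s → z ∉ convexHull ℝ r := by
  simp [relInt]

lemma ne_of_cross_ne_zero {p q r : ℂ} (h : cross p q r ≠ 0) : p ≠ q ∧ q ≠ r ∧ r ≠ p := by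
  refine ⟨?_, ?_, ?_⟩ <;> rintro rfl <;> apply h <;> simp [cross, mul_comm]

lemma mem_relInt_triple {p q r : ℂ} (h : cross p q r ≠ 0) {z : ℂ} :
    z ∈ relInt {p, q, r} ↔ ∃ u v w : ℝ, 0 < u ∧ 0 < v ∧ 0 < w ∧ u + v + w = 1 ∧
      z = u • p + v • q + w • r := by
  obtain ⟨hpq, hqr, hrp⟩ := ne_of_cross_ne_zero h
  rw [mem_relInt]
  constructor
  · rintro ⟨hz, hr⟩
    obtain ⟨u, v, w, hu, hv, hw, hs, rfl⟩ := mem_convexHull_triple.1 hz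
    -- A vanishing weight would put the point in the hull of the opposite edge, which is a proper
    -- subset of the vertices.
    have key : ∀ x y m : ℂ, m ∈ ({p, q, r} : Set ℂ) → m ≠ x → m ≠ y →
        ({x, y} : Set ℂ) ⊆ {p, q, r} →
        u • p + v • q + w • r ∉ convexHull ℝ ({x, y} : Set ℂ) := by
      intro x y m hm hx hy hsub
      exact hr _ ⟨hsub, fun h' => by rcases h' hm with h | h <;> simp_all⟩
    refine ⟨u, v, w, hu.lt_of_ne ?_, hv.lt_of_ne ?_, hw.lt_of_ne ?_, hs, rfl⟩
    · rintro rfl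
      exact key q r p (by simp) hpq hrp.symm (by simp)
        (mem_convexHull_pair.2 ⟨v, w, hv, hw, by linarith, by module⟩)
    · rintro rfl
      exact key p r q (by simp) hpq.symm hqr (by simp [Set.insert_subset_iff])
        (mem_convexHull_pair.2 ⟨u, w, hu, hw, by linarith, by module⟩)
    · rintro rfl
      exact key p q r (by simp) hrp hqr.symm (by simp [Set.insert_subset_iff])
        (mem_convexHull_pair.2 ⟨u, v, hu, hv, by linarith, by module⟩)
  · rintro ⟨u, v, w, hu, hv, hw, hs, rfl⟩
    refine ⟨mem_convexHull_triple.2 ⟨u, v, w, hu.le, hv.le, hw.le, hs, rfl⟩, fun t ht hz => ?_⟩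
    -- A proper subset misses a vertex, so its hull lies on the line of the opposite edge, where
    -- `cross` vanishes. But there `cross` equals the weight of the missing vertex times the area of
    -- the triangle.
    have key : ∀ x y : ℂ, t ⊆ {x, y} → cross x y (u • p + v • q + w • r) = 0 := by
      intro x y hxy
      obtain ⟨a, b, -, -, hab, h'⟩ := mem_convexHull_pair.1 (convexHull_mono hxy hz)
      rw [h', cross_combo_pair hab, cross_left, cross_right]; ring
    obtain ⟨m, hm, hmt⟩ := Set.exists_of_ssubset ht
    have hsub : ∀ x ∈ t, (x = p ∨ x = q ∨ x = r) ∧ x ≠ m :=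
      fun x hx => ⟨by simpa using ht.1 hx, by rintro rfl; exact hmt hx⟩
    rcases hm with rfl | rfl | rfl
    · have := key q r (fun x hx => by have := hsub x hx; simp; tauto)
      rw [cross_combo hs, cross_left, cross_right, cross_rotate] at this
      simp [hu.ne', h] at this
    · have := key r p (fun x hx => by have := hsub x hx; simp; tauto)
      rw [cross_combo hs, cross_left, cross_right, ← cross_rotate r p] at this
      simp [hv.ne', h] at this
    · have := key p q (fun x hx => by have := hsub x hx; simp; tauto)
      rw [cross_combo hs, cross_left, cross_right] at this
      simp [hw.ne', h] at this

lemma mem_relInt_pair {p q : ℂ} (h : p ≠ q) {z : ℂ} :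
    z ∈ relInt {p, q} ↔ ∃ u v : ℝ, 0 < u ∧ 0 < v ∧ u + v = 1 ∧ z = u • p + v • q := by
  rw [mem_relInt]
  constructor
  · rintro ⟨hz, hr⟩
    obtain ⟨u, v, hu, hv, hs, rfl⟩ := mem_convexHull_pair.1 hz
    refine ⟨u, v, hu.lt_of_ne ?_, hv.lt_of_ne ?_, hs, rfl⟩
    · rintro rfl
      refine hr {q} ⟨by simp, fun h' => h (h' (by simp))⟩ ?_
      simp_all
    · rintro rfl
      refine hr {p} ⟨by simp, fun h' => h (h' (by simp : q ∈ _)).symm⟩ ?_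
      simp_all
  · rintro ⟨u, v, hu, hv, hs, rfl⟩
    refine ⟨mem_convexHull_pair.2 ⟨u, v, hu.le, hv.le, hs, rfl⟩, fun t ht hz => ?_⟩
    obtain ⟨m, hm, hmt⟩ := Set.exists_of_ssubset ht
    have hsub : ∀ x ∈ t, (x = p ∨ x = q) ∧ x ≠ m :=
      fun x hx => ⟨by simpa using ht.1 hx, by rintro rfl; exact hmt hx⟩
    obtain rfl : u = 1 - v := by linarith
    rcases hm with rfl | rfl
    · have h1 : t ⊆ {q} := fun x hx => by have := hsub x hx; simp; tauto
      have h2 := convexHull_mono (𝕜 := ℝ) h1 hz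
      rw [convexHull_singleton, Set.mem_singleton_iff, ← sub_eq_zero] at h2
      have h3 : (1 - v) • (m - q) = 0 := by rw [← h2]; module
      rcases smul_eq_zero.1 h3 with h4 | h4
      · exact hu.ne' h4
      · exact h (sub_eq_zero.1 h4)
    · have h1 : t ⊆ {p} := fun x hx => by have := hsub x hx; simp; tauto
      have h2 := convexHull_mono (𝕜 := ℝ) h1 hz
      rw [convexHull_singleton, Set.mem_singleton_iff, ← sub_eq_zero] at h2
      have h3 : v • (m - p) = 0 := by rw [← h2]; module
      rcases smul_eq_zero.1 h3 with h4 | h4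
      · exact hv.ne' h4
      · exact h (sub_eq_zero.1 h4).symm

lemma collinear_iff_cross_eq_zero {p q r : ℂ} : Collinear ℝ {p, q, r} ↔ cross p q r = 0 := by
  rw [collinear_iff_of_mem (p₀ := p) (by simp)]
  constructor
  · rintro ⟨v, hv⟩
    obtain ⟨s, hs⟩ := hv q (by simp)
    obtain ⟨t, ht⟩ := hv r (by simp)
    rw [hs, ht]
    simp [cross]
    ring
  · intro h
    by_cases hpq : p = q
    · subst hpq
      refine ⟨r - p, ?_⟩
      rintro x (rfl | rfl | rfl)
      · exact ⟨0, by simp⟩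
      · exact ⟨0, by simp⟩
      · exact ⟨1, by simp⟩
    refine ⟨q - p, ?_⟩
    have hn : Complex.normSq (q - p) ≠ 0 := by
      simpa [sub_eq_zero] using fun h => hpq h.symm
    rintro x (rfl | rfl | rfl)
    · exact ⟨0, by simp⟩
    · exact ⟨1, by simp⟩
    -- The scalar is the coefficient of the orthogonal projection of x - p onto q - p.
    · refine ⟨((x.re - p.re) * (q.re - p.re) + (x.im - p.im) * (q.im - p.im))
        / Complex.normSq (q - p), ?_⟩
      simp only [cross] at h
      rw [vadd_eq_add, ← sub_eq_iff_eq_add]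
      apply Complex.ext
      · simp only [Complex.sub_re, Complex.real_smul, Complex.re_ofReal_mul]
        rw [div_mul_eq_mul_div, eq_div_iff hn, Complex.normSq_apply]
        simp only [Complex.sub_re, Complex.sub_im]
        linear_combination -(q.im - p.im) * h
      · simp only [Complex.sub_im, Complex.real_smul, Complex.im_ofReal_mul]
        rw [div_mul_eq_mul_div, eq_div_iff hn, Complex.normSq_apply]
        simp only [Complex.sub_re, Complex.sub_im]
        linear_combination (q.re - p.re) * h

lemma cross_ne_zero_of_notMem_segment {p q r : ℂ} (hp : p ∉ segment ℝ q r)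
    (hq : q ∉ segment ℝ r p) (hr : r ∉ segment ℝ p q) : cross p q r ≠ 0 := by
  intro h0
  have hcol := collinear_iff_cross_eq_zero.2 h0
  rcases hcol.wbtw_or_wbtw_or_wbtw with h | h | h
  · exact hq (by rw [segment_symm]; exact mem_segment_iff_wbtw.2 h)
  · exact hr (by rw [segment_symm]; exact mem_segment_iff_wbtw.2 h)
  · exact hp (by rw [segment_symm]; exact mem_segment_iff_wbtw.2 h)

lemma notMem_segment_of_cross_ne_zero {p q r : ℂ} (h : cross p q r ≠ 0) :
    r ∉ segment ℝ p q := by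
  rintro ⟨u, v, -, -, huv, rfl⟩
  rw [cross_combo_pair huv, cross_left, cross_right] at h
  simp at h

/-- Triangles with a common edge, on the same side of it, overlap. -/
lemma relInt_inter_nonempty {p q r s : ℂ} (h : 0 < cross p q r * cross p q s) :
    (relInt {p, q, r} ∩ relInt {p, q, s}).Nonempty := by
  have hr : cross p q r ≠ 0 := by rintro h'; simp [h'] at h
  have hs : cross p q s ≠ 0 := by rintro h'; simp [h'] at h
  obtain ⟨he, hsum⟩ := exists_weights hs r
  have hw : 0 < cross p q r / cross p q s := by
    rw [← mul_div_mul_right _ _ hs]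
    exact div_pos h (mul_self_pos.2 hs)
  set u := cross q s r / cross p q s
  set v := cross s p r / cross p q s
  set w := cross p q r / cross p q s
  -- The common point is the midpoint of pq pushed slightly towards r. In the coordinates of the
  -- triangle p q s its first two weights are (1 - ε)/2 plus εu or εv, and this ε keeps them
  -- positive.
  set ε := 1 / (4 * (1 + |u| + |v|)) with hε
  have hε0 : 0 < ε := by positivity
  have h4 : ε + ε * |u| + ε * |v| = 1 / 4 := by
    rw [hε]; field_simp
  have hu : -(ε * |u|) ≤ ε * u := by
    rw [← mul_neg]; exact mul_le_mul_of_nonneg_left (neg_abs_le u) hε0.le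
  have hv : -(ε * |v|) ≤ ε * v := by
    rw [← mul_neg]; exact mul_le_mul_of_nonneg_left (neg_abs_le v) hε0.le
  have hu' : 0 ≤ ε * |u| := by positivity
  have hv' : 0 ≤ ε * |v| := by positivity
  refine ⟨((1 - ε) / 2) • p + ((1 - ε) / 2) • q + ε • r, (mem_relInt_triple hr).2
    ⟨_, _, _, by linarith, by linarith, hε0, by ring, rfl⟩, (mem_relInt_triple hs).2
    ⟨(1 - ε) / 2 + ε * u, (1 - ε) / 2 + ε * v, ε * w, by linarith, by linarith, by positivity,
      ?_, ?_⟩⟩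
  · linear_combination ε * hsum
  · linear_combination (norm := module) ε • he

/-- `a c b d` is a strictly convex quadrilateral: its diagonals `a b` and `c d` cross. -/
structure Crossing (a b c d : ℂ) : Prop where
  meet : ∃ α β γ δ : ℝ, 0 < α ∧ 0 < β ∧ 0 < γ ∧ 0 < δ ∧ α + β = 1 ∧ γ + δ = 1 ∧
    α • a + β • b = γ • c + δ • d
  ne₁ : cross a b c ≠ 0
  ne₂ : cross a b d ≠ 0
  ne₃ : cross c d a ≠ 0
  ne₄ : cross c d b ≠ 0

/-! ### Quadrilaterals with crossing diagonals. -/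

namespace Crossing

variable {a b c d : ℂ}

lemma symm (h : Crossing a b c d) : Crossing c d a b :=
  ⟨by
    obtain ⟨α, β, γ, δ, hα, hβ, hγ, hδ, h1, h2, h3⟩ := h.meet
    exact ⟨γ, δ, α, β, hγ, hδ, hα, hβ, h2, h1, h3.symm⟩, h.ne₃, h.ne₄, h.ne₁, h.ne₂⟩

lemma swap_left (h : Crossing a b c d) : Crossing b a c d :=
  ⟨by
    obtain ⟨α, β, γ, δ, hα, hβ, hγ, hδ, h1, h2, h3⟩ := h.meet
    exact ⟨β, α, γ, δ, hβ, hα, hγ, hδ, by linarith, h2, by rw [← h3, add_comm]⟩,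
    by rw [cross_swap]; exact neg_ne_zero.2 h.ne₁, by rw [cross_swap]; exact neg_ne_zero.2 h.ne₂,
    h.ne₄, h.ne₃⟩

lemma swap_right (h : Crossing a b c d) : Crossing a b d c :=
  h.symm.swap_left.symm

lemma cross_mul_neg (h : Crossing a b c d) : cross a b c * cross a b d < 0 := by
  obtain ⟨α, β, γ, δ, hα, hβ, hγ, hδ, h1, h2, h3⟩ := h.meet
  have := congrArg (cross a b) h3
  rw [cross_combo_pair h1, cross_combo_pair h2, cross_left, cross_right] at this
  have e : cross a b c = -(δ / γ) * cross a b d := by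
    field_simp; linarith
  rw [e, mul_assoc]
  have := mul_self_pos.2 h.ne₂
  have : 0 < δ / γ := by positivity
  nlinarith

/-- Write the weights of a and b as multiples k and l of those of the crossing point. The common
multiple min(k, l) of αa + βb can be rewritten as γc + δd, which leaves only one of a and b; the
sign of k - l tells on which side of cd the point lies. The weight w may vanish so that the open
edge ab is covered as well. The cells after the flip are `quadCells c d b a`, in this order of
arguments. -/
lemma mem_of_weights (h : Crossing a b c d) {u v w : ℝ} (hu : 0 < u) (hv : 0 < v) (hw : 0 ≤ w)
    (hs : u + v + w = 1) :
    ∃ t ∈ quadCells c d b a, u • a + v • b + w • c ∈ relInt t := by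
  obtain ⟨α, β, γ, δ, hα, hβ, hγ, hδ, h1, h2, h3⟩ := h.meet
  obtain ⟨k, rfl⟩ : ∃ k, u = k * α := ⟨u / α, by field_simp⟩
  obtain ⟨l, rfl⟩ : ∃ l, v = l * β := ⟨v / β, by field_simp⟩
  have hk : 0 < k := pos_of_mul_pos_left hu hα.le
  have hl : 0 < l := pos_of_mul_pos_left hv hβ.le
  rcases lt_trichotomy k l with hkl | rfl | hkl
  · refine ⟨{c, d, b}, by simp [quadCells], (mem_relInt_triple h.ne₄).2
      ⟨w + k * γ, k * δ, (l - k) * β, by positivity, by positivity,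
        mul_pos (sub_pos.2 hkl) hβ, ?_, ?_⟩⟩
    · linear_combination hs + k * h2 - k * h1
    · linear_combination (norm := module) k • h3
  · refine ⟨{c, d}, by simp [quadCells], (mem_relInt_pair (ne_of_cross_ne_zero h.ne₃).1).2
      ⟨w + k * γ, k * δ, by positivity, by positivity, ?_, ?_⟩⟩
    · linear_combination hs + k * h2 - k * h1
    · linear_combination (norm := module) k • h3
  · refine ⟨{d, c, a}, by simp [quadCells], (mem_relInt_triple (by
        rw [cross_swap]; exact neg_ne_zero.2 h.ne₃)).2
      ⟨l * δ, w + l * γ, (k - l) * α, by positivity, by positivity,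
        mul_pos (sub_pos.2 hkl) hα, ?_, ?_⟩⟩
    · linear_combination hs + l * h2 - l * h1
    · linear_combination (norm := module) l • h3

/-- The open quadrilateral is covered by the cells at either diagonal. -/
lemma exchange (h : Crossing a b c d) {s : Set ℂ}
    (hs : s ∈ quadCells a b c d) {z : ℂ} (hz : z ∈ relInt s) :
    ∃ t ∈ quadCells c d b a, z ∈ relInt t := by
  rcases hs with rfl | rfl | rfl
  · obtain ⟨u, v, w, hu, hv, hw, hs, rfl⟩ := (mem_relInt_triple h.ne₁).1 hz
    exact h.mem_of_weights hu hv hw.le hs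
  · obtain ⟨u, v, w, hu, hv, hw, hs, rfl⟩ := (mem_relInt_triple h.swap_left.ne₂).1 hz
    obtain ⟨t, ht, h'⟩ := h.swap_left.swap_right.mem_of_weights hu hv hw.le hs
    refine ⟨t, ?_, h'⟩
    rcases ht with rfl | rfl | rfl
    · simp [quadCells]
    · simp [quadCells]
    · simp [quadCells, Set.pair_comm d c]
  · obtain ⟨u, v, hu, hv, hs, rfl⟩ := (mem_relInt_pair (ne_of_cross_ne_zero h.ne₁).1).1 hz
    simpa using h.mem_of_weights hu hv le_rfl (by linarith)

lemma exchange_symm (h : Crossing a b c d) {s : Set ℂ}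
    (hs : s ∈ quadCells c d b a) {z : ℂ} (hz : z ∈ relInt s) :
    ∃ t ∈ quadCells a b c d, z ∈ relInt t := by
  obtain ⟨t, ht, h'⟩ := h.symm.swap_right.exchange (s := s) hs hz
  refine ⟨t, ?_, h'⟩
  rcases ht with rfl | rfl | rfl
  · simp [quadCells, Set.insert_comm b a]
  · simp [quadCells, Set.insert_comm b a]
  · simp [quadCells, Set.pair_comm b a]

lemma relInt_unique (h : Crossing a b c d) {s t : Set ℂ}
    (hs : s ∈ quadCells c d b a)
    (ht : t ∈ quadCells c d b a) {z : ℂ}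
    (hzs : z ∈ relInt s) (hzt : z ∈ relInt t) : s = t := by
  -- The three new cells are told apart by the side of the line cd, measured relative to b.
  have key : ∀ s ∈ quadCells c d b a, z ∈ relInt s →
      (s = {c, d, b} ∧ 0 < cross c d z * cross c d b) ∨
      (s = {d, c, a} ∧ cross c d z * cross c d b < 0) ∨ 
      (s = {c, d} ∧ cross c d z * cross c d b = 0) := by
    rintro s (rfl | rfl | rfl) hz
    · obtain ⟨u, v, w, hu, hv, hw, hs, rfl⟩ := (mem_relInt_triple h.ne₄).1 hz
      refine Or.inl ⟨rfl, ?_⟩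
      rw [cross_combo hs, cross_left, cross_right]
      have := mul_self_pos.2 h.ne₄
      nlinarith
    · obtain ⟨u, v, w, hu, hv, hw, hs, rfl⟩ := (mem_relInt_triple h.symm.swap_left.ne₁).1 hz
      refine Or.inr (Or.inl ⟨rfl, ?_⟩)
      rw [cross_combo hs, cross_left, cross_right]
      have := h.symm.cross_mul_neg
      nlinarith
    · obtain ⟨u, v, hu, hv, hs, rfl⟩ := (mem_relInt_pair (ne_of_cross_ne_zero h.ne₄).1).1 hz
      refine Or.inr (Or.inr ⟨rfl, ?_⟩)
      rw [cross_combo_pair hs, cross_left, cross_right]; ring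
  rcases key s hs hzs with ⟨rfl, h1⟩ | ⟨rfl, h1⟩ | ⟨rfl, h1⟩ <;>
    rcases key t ht hzt with ⟨rfl, h2⟩ | ⟨rfl, h2⟩ | ⟨rfl, h2⟩ <;>
    first | rfl | (exfalso; linarith)

/-- The hull of b, c, d stays on the closed side of cd that contains b, and a is strictly on the
other side. -/
lemma notMem_hull (h : Crossing a b c d) : a ∉ convexHull ℝ {b, c, d} := by
  intro hz
  obtain ⟨u, v, w, hu, hv, hw, hs, he⟩ := mem_convexHull_triple.1 hz
  have := congrArg (cross c d) he
  rw [cross_combo hs, cross_left, cross_right] at this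
  have h1 := h.symm.cross_mul_neg
  have h2 := mul_self_pos.2 h.ne₄
  rw [this] at h1
  nlinarith

lemma convex_union (h : Crossing a b c d) :
    Convex ℝ (convexHull ℝ {a, b, c} ∪ convexHull ℝ {a, b, d}) := by
  have key : convexHull ℝ {a, b, c} ∪ convexHull ℝ {a, b, d} = convexHull ℝ {a, b, c, d} := by
    apply Set.Subset.antisymm
    · refine Set.union_subset (convexHull_mono ?_) (convexHull_mono ?_) <;>
        simp [Set.insert_subset_iff]
    · intro z hz
      rw [convexHull_insert (by simp), mem_convexJoin] at hz
      obtain ⟨a', ha, y, hy, s, t, hs, ht, hst, rfl⟩ := hz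
      rw [Set.mem_singleton_iff] at ha
      subst ha
      obtain ⟨u, v, w, hu, hv, hw, hsum, rfl⟩ := mem_convexHull_triple.1 hy
      obtain ⟨α, β, γ, δ, hα, hβ, hγ, hδ, h1, h2, h3⟩ := h.meet
      obtain ⟨k, rfl⟩ : ∃ k, v = k * γ := ⟨v / γ, by field_simp⟩
      obtain ⟨l, rfl⟩ : ∃ l, w = l * δ := ⟨w / δ, by field_simp⟩
      have hk : 0 ≤ k := nonneg_of_mul_nonneg_left hv hγ
      have hl : 0 ≤ l := nonneg_of_mul_nonneg_left hw hδ
      -- The exchange of `mem_of_weights` with the diagonals interchanged: the smaller multiple of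
      -- γc + δd becomes αa + βb, and only one of c and d remains.
      rcases le_total k l with hkl | hkl
      · refine Or.inr (mem_convexHull_triple.2 ⟨s + t * k * α, t * u + t * k * β,
          t * ((l - k) * δ), by positivity, by positivity,
          mul_nonneg ht (mul_nonneg (sub_nonneg.2 hkl) hδ.le), ?_, ?_⟩)
        · linear_combination hst + t * hsum + t * k * h1 - t * k * h2
        · linear_combination (norm := module) -(t * k) • h3
      · refine Or.inl (mem_convexHull_triple.2 ⟨s + t * l * α, t * u + t * l * β,
          t * ((k - l) * γ), by positivity, by positivity,
          mul_nonneg ht (mul_nonneg (sub_nonneg.2 hkl) hγ.le), ?_, ?_⟩)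
        · linear_combination hst + t * hsum + t * l * h1 - t * l * h2
        · linear_combination (norm := module) -(t * l) • h3
  rw [key]
  exact convex_convexHull ℝ _

end Crossing

/-- In the relation `hM` the coefficients of c and d have known signs. If `cross c d a` were
positive, then so would be `cross c d b`, and solving for a would put it inside cdb; if `cross c d
b` were negative, solving for b would put it inside dca. With both excluded, dividing `hM` by the
total area gives the crossing point. -/
lemma crossing_of_pos_of_neg {a b c d : ℂ} (hc : 0 < cross a b c) (hd : cross a b d < 0)
    (ha : cross c d a ≠ 0) (hb : cross c d b ≠ 0) (hac : a ∉ relInt {c, d, b})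
    (hbc : b ∉ relInt {d, c, a}) : Crossing a b c d := by
  have hσ : cross c d b - cross c d a = cross a b c - cross a b d := by
    simp only [cross]; ring
  have hM : cross a b c • d - cross a b d • c = cross c d b • a - cross c d a • b := by
    apply Complex.ext <;> simp [cross] <;> ring
  have ha' : cross c d a < 0 := by
    by_contra! h
    have h3 := h.lt_of_ne' ha
    have h4 : 0 < cross c d b := by linarith
    refine hac ((mem_relInt_triple hb).2 ⟨-cross a b d / cross c d b, cross a b c / cross c d b,
      cross c d a / cross c d b, div_pos (by linarith) h4, by positivity, by positivity, ?_, ?_⟩)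
    · rw [← add_div, ← add_div, div_eq_one_iff_eq h4.ne']; linarith
    · apply smul_right_injective ℂ h4.ne'
      simp only [smul_add, smul_smul, mul_div_cancel₀ _ h4.ne']
      linear_combination (norm := module) -hM
  have hb' : 0 < cross c d b := by
    by_contra! h
    have h3 := h.lt_of_ne hb
    have h4 : 0 < cross d c a := by rw [cross_swap]; linarith
    refine hbc ((mem_relInt_triple h4.ne').2 ⟨cross a b c / cross d c a,
      -cross a b d / cross d c a, -cross c d b / cross d c a,
      by positivity, div_pos (by linarith) h4, div_pos (by linarith) h4, ?_, ?_⟩)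
    · rw [← add_div, ← add_div, div_eq_one_iff_eq h4.ne', cross_swap c d a]; linarith
    · apply smul_right_injective ℂ h4.ne'
      simp only [smul_add, smul_smul, mul_div_cancel₀ _ h4.ne']
      rw [cross_swap c d a]
      linear_combination (norm := module) -hM
  have hpos : 0 < cross a b c - cross a b d := by linarith
  refine ⟨⟨cross c d b / (cross a b c - cross a b d), -cross c d a / (cross a b c - cross a b d),
    -cross a b d / (cross a b c - cross a b d), cross a b c / (cross a b c - cross a b d),
    by positivity, div_pos (by linarith) hpos, div_pos (by linarith) hpos, by positivity,
    ?_, ?_, ?_⟩, hc.ne', hd.ne, ha, hb⟩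
  · rw [← add_div, div_eq_one_iff_eq hpos.ne']; linarith
  · rw [← add_div, div_eq_one_iff_eq hpos.ne']; linarith
  · apply smul_right_injective ℂ hpos.ne'
    simp only [smul_add, smul_smul, mul_div_cancel₀ _ hpos.ne']
    linear_combination (norm := module) -hM

lemma crossing_of_cross_mul_neg {a b c d : ℂ} (h : cross a b c * cross a b d < 0)
    (ha : cross c d a ≠ 0) (hb : cross c d b ≠ 0) (hac : a ∉ relInt {c, d, b})
    (hbc : b ∉ relInt {d, c, a}) : Crossing a b c d := by
  rcases mul_neg_iff.1 h with ⟨h1, h2⟩ | ⟨h1, h2⟩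
  · exact crossing_of_pos_of_neg h1 h2 ha hb hac hbc
  · refine (crossing_of_pos_of_neg (a := b) (b := a) ?_ ?_ hb ha ?_ ?_).swap_left
    · rw [cross_swap]; linarith
    · rw [cross_swap]; linarith
    · rwa [Set.insert_comm]
    · rwa [Set.insert_comm]

end Planar

lemma image_ssubset_image_iff_of_injective {α β : Type*} {f : α → β} (hf : Function.Injective f)
    {s t : Set α} : f '' s ⊂ f '' t ↔ s ⊂ t := by
  simp only [ssubset_iff_subset_not_subset, Set.image_subset_image_iff hf]

section Perm

variable {X : Type}

lemma perm_inv_apply_self (g : Equiv.Perm X) (x : X) : (g⁻¹ : Equiv.Perm X) (g x) = x := by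
  simp

lemma perm_apply_inv_self (g : Equiv.Perm X) (x : X) : g ((g⁻¹ : Equiv.Perm X) x) = x := by
  simp

lemma image_inv_image (g : Equiv.Perm X) (s : Set X) : (g⁻¹ : Equiv.Perm X) '' (g '' s) = s := by
  rw [← Set.image_comp, ← Equiv.Perm.coe_mul, inv_mul_cancel, Equiv.Perm.coe_one, Set.image_id]

lemma image_image_inv (g : Equiv.Perm X) (s : Set X) : g '' ((g⁻¹ : Equiv.Perm X) '' s) = s := by
  rw [← Set.image_comp, ← Equiv.Perm.coe_mul, mul_inv_cancel, Equiv.Perm.coe_one, Set.image_id]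

lemma image_mul (g h : Equiv.Perm X) (s : Set X) : (g * h : Equiv.Perm X) '' s = g '' (h '' s) := by
  rw [← Set.image_comp, Equiv.Perm.coe_mul]

end Perm

/-! ### Transfer of geodesic notions through a straight chart. -/

section Charts

variable {X : Type} [MetricSpace X]

/-- A chart in which geodesic segments are straight, with convex image. -/
structure IsStraightChart (ψ : X → ℂ) : Prop where
  injective : Function.Injective ψ
  mem_geodSegment : ∀ x y z, z ∈ geodSegment x y ↔ ψ z ∈ segment ℝ (ψ x) (ψ y)
  convex_range : Convex ℝ (Set.range ψ)

namespace IsStraightChart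

variable {ψ : X → ℂ} (hψ : IsStraightChart ψ)
include hψ

/-- Convexity of the range is what lets every point of a straight segment between image points be
lifted. -/
lemma geodConvex_iff {c : Set X} : GeodConvex c ↔ Convex ℝ (ψ '' c) := by
  rw [convex_iff_segment_subset]
  constructor
  · rintro hc _ ⟨x, hx, rfl⟩ _ ⟨y, hy, rfl⟩ z hz
    obtain ⟨w, rfl⟩ := hψ.convex_range.segment_subset ⟨x, rfl⟩ ⟨y, rfl⟩ hz
    exact ⟨w, hc hx hy ((hψ.mem_geodSegment x y w).2 hz), rfl⟩
  · intro hc x hx y hy z hz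
    obtain ⟨w, hw, h⟩ := hc ⟨x, hx, rfl⟩ ⟨y, hy, rfl⟩ ((hψ.mem_geodSegment x y z).1 hz)
    rwa [← hψ.injective h]

lemma image_geodHull (s : Set X) : ψ '' geodHull s = convexHull ℝ (ψ '' s) := by
  apply Set.Subset.antisymm
  · rintro _ ⟨x, hx, rfl⟩
    refine hx (ψ ⁻¹' convexHull ℝ (ψ '' s))
      ⟨fun y hy => subset_convexHull ℝ _ ⟨y, hy, rfl⟩, fun y hy z hz w hw => ?_⟩
    exact (convex_convexHull ℝ _).segment_subset hy hz ((hψ.mem_geodSegment y z w).1 hw)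
  · intro z hz
    have hr : convexHull ℝ (ψ '' s) ⊆ Set.range ψ :=
      convexHull_min (Set.image_subset_range _ _) hψ.convex_range
    obtain ⟨x, rfl⟩ := hr hz
    refine ⟨x, fun c hc => ?_, rfl⟩
    obtain ⟨y, hy, h⟩ := convexHull_min (Set.image_mono hc.1) (hψ.geodConvex_iff.1 hc.2) hz
    rwa [← hψ.injective h]

lemma mem_geodHull {s : Set X} {x : X} : x ∈ geodHull s ↔ ψ x ∈ convexHull ℝ (ψ '' s) := by
  rw [← hψ.image_geodHull, hψ.injective.mem_set_image]

lemma mem_openCell {s : Set X} {x : X} : x ∈ openCell s ↔ ψ x ∈ relInt (ψ '' s) := by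
  rw [mem_relInt, openCell, Set.mem_sdiff, hψ.mem_geodHull]
  simp only [Set.mem_ofPred_eq, Set.mem_iUnion, not_exists, hψ.mem_geodHull]
  refine and_congr_right fun _ => ⟨fun h r hr => ?_, fun h r hr => ?_⟩
  · obtain ⟨r', -, rfl⟩ := Set.subset_image_iff.1 hr.1
    exact h r' ((image_ssubset_image_iff_of_injective hψ.injective).1 hr)
  · exact h _ ((image_ssubset_image_iff_of_injective hψ.injective).2 hr)

lemma mem_openCell_triple {p q r x : X} :
    x ∈ openCell {p, q, r} ↔ ψ x ∈ relInt {ψ p, ψ q, ψ r} := by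
  rw [hψ.mem_openCell, Set.image_insert_eq, Set.image_pair]

lemma mem_geodHull_triple {p q r x : X} :
    x ∈ geodHull {p, q, r} ↔ ψ x ∈ convexHull ℝ {ψ p, ψ q, ψ r} := by
  rw [hψ.mem_geodHull, Set.image_insert_eq, Set.image_pair]

lemma nonCollinear_iff {p q r : X} : NonCollinear p q r ↔ cross (ψ p) (ψ q) (ψ r) ≠ 0 := by
  simp only [NonCollinear, hψ.mem_geodSegment]
  refine ⟨fun h => cross_ne_zero_of_notMem_segment h.1 h.2.1 h.2.2, fun h =>
    ⟨notMem_segment_of_cross_ne_zero ?_, notMem_segment_of_cross_ne_zero ?_,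
      notMem_segment_of_cross_ne_zero h⟩⟩
  · rwa [cross_rotate]
  · rwa [← cross_rotate (ψ r)]

/-- In the chart, a convex quadrilateral with crossing diagonals. -/
lemma strictlyConvexQuad {a b c d : X} (h : Crossing (ψ a) (ψ b) (ψ c) (ψ d)) :
    StrictlyConvexQuad a b c d := by
  refine ⟨?_, ?_, ?_, ?_, ?_⟩
  · rw [hψ.geodConvex_iff, Set.image_union, hψ.image_geodHull, hψ.image_geodHull]
    simpa only [Set.image_insert_eq, Set.image_singleton] using h.convex_union
  · rw [hψ.mem_geodHull_triple]; exact h.notMem_hull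
  · rw [hψ.mem_geodHull_triple]; exact h.swap_left.notMem_hull
  · rw [hψ.mem_geodHull_triple, Set.pair_comm, Set.insert_comm]
    exact h.symm.notMem_hull ∘ by
      rw [Set.insert_comm, Set.pair_comm, Set.insert_comm]; exact id
  · rw [hψ.mem_geodHull_triple]
    exact h.symm.swap_left.notMem_hull ∘ by
      rw [Set.insert_comm (ψ c), Set.pair_comm (ψ c)]; exact id

end IsStraightChart

end Charts

/-! ### Geodesic hulls and open cells under isometries. -/

section Isometries

variable {X : Type} [MetricSpace X]

lemma GeodConvex.preimage {g : Equiv.Perm X} (hg : Isometry g) {c : Set X} (hc : GeodConvex c) :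
    GeodConvex (g ⁻¹' c) := by
  intro x hx y hy z hz
  refine hc hx hy ?_
  simpa only [geodSegment, Set.mem_ofPred_eq, hg.dist_eq] using hz

lemma isometry_inv {g : Equiv.Perm X} (hg : Isometry g) : Isometry (g⁻¹ : Equiv.Perm X) :=
  hg.right_inv g.right_inv

lemma apply_mem_geodHull {g : Equiv.Perm X} (hg : Isometry g) {s : Set X} {x : X}
    (hx : x ∈ geodHull s) : g x ∈ geodHull (g '' s) := by
  rintro c ⟨hsc, hc⟩
  exact hx _ ⟨Set.image_subset_iff.1 hsc, hc.preimage hg⟩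

lemma apply_mem_geodHull_iff {g : Equiv.Perm X} (hg : Isometry g) {s : Set X} {x : X} :
    g x ∈ geodHull (g '' s) ↔ x ∈ geodHull s := by
  refine ⟨fun h => ?_, apply_mem_geodHull hg⟩
  have := apply_mem_geodHull (isometry_inv hg) h
  rwa [image_inv_image, perm_inv_apply_self] at this

lemma apply_mem_openCell {g : Equiv.Perm X} (hg : Isometry g) {s : Set X} {x : X} :
    g x ∈ openCell (g '' s) ↔ x ∈ openCell s := by
  simp only [openCell, Set.mem_sdiff, apply_mem_geodHull_iff hg, Set.mem_iUnion, not_exists,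
    Set.mem_ofPred_eq]
  refine and_congr_right fun _ => ⟨fun h r hr hx => ?_, fun h r hr hx => ?_⟩
  · exact h _ ((image_ssubset_image_iff_of_injective g.injective).2 hr) (apply_mem_geodHull hg hx)
  · obtain ⟨r', -, rfl⟩ := Set.subset_image_iff.1 hr.1
    exact h r' ((image_ssubset_image_iff_of_injective g.injective).1 hr) ((apply_mem_geodHull_iff hg).1 hx)

lemma inv_apply_mem_openCell {g : Equiv.Perm X} (hg : Isometry g) {s : Set X} {x : X} :
    (g⁻¹ : Equiv.Perm X) x ∈ openCell s ↔ x ∈ openCell (g '' s) := by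
  rw [← apply_mem_openCell hg, perm_apply_inv_self]

lemma NonCollinear.map {g : Equiv.Perm X} (hg : Isometry g) {p q r : X} (h : NonCollinear p q r) :
    NonCollinear (g p) (g q) (g r) := by
  simpa only [NonCollinear, geodSegment, Set.mem_ofPred_eq, hg.dist_eq] using h

end Isometries

/-! ### The flippable quadrilateral and its translates under the group. -/

section Flips

variable {X : Type} [MetricSpace X] {ψ : X → ℂ} {Γ : Subgroup (Equiv.Perm X)}
  {V : Set (Surface Γ)} {F : Set (Set X)} {a b c d : X}

/-- A group of isometries that acts freely, without permuting two or three points cyclically, and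
preserves the orientation. -/
structure IsOrientedAction (ψ : X → ℂ) (Γ : Subgroup (Equiv.Perm X)) : Prop where
  isometry : ∀ g ∈ Γ, Isometry g
  free : ∀ g ∈ Γ, ∀ x, g x = x → g = 1
  free_two : ∀ g ∈ Γ, ∀ x, g (g x) = x → g = 1
  free_three : ∀ g ∈ Γ, ∀ x, g (g (g x)) = x → g = 1
  orientation : ∀ g ∈ Γ, ∀ x y z, 0 < cross (ψ x) (ψ y) (ψ z) →
    0 < cross (ψ (g x)) (ψ (g y)) (ψ (g z))

lemma IsOrientedAction.cross_mul_pos (hΓ : IsOrientedAction ψ Γ) {g : Equiv.Perm X} (hg : g ∈ Γ)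
    {x y z : X} (h : cross (ψ x) (ψ y) (ψ z) ≠ 0) :
    0 < cross (ψ x) (ψ y) (ψ z) * cross (ψ (g x)) (ψ (g y)) (ψ (g z)) := by
  rcases h.lt_or_gt with h | h
  · have h1 : 0 < cross (ψ y) (ψ x) (ψ z) := by rw [cross_swap]; linarith
    have h2 := hΓ.orientation g hg _ _ _ h1
    rw [cross_swap] at h2
    exact mul_pos_of_neg_of_neg h (by linarith)
  · exact mul_pos h (hΓ.orientation g hg _ _ _ h)

/-- A permutation of at most three points has a fixed point, swaps two points or is a 3-cycle, and
each case is excluded for a nontrivial element. The points need not be distinct here. -/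
lemma IsOrientedAction.eq_one_of_image_triple (hΓ : IsOrientedAction ψ Γ) {g : Equiv.Perm X}
    (hg : g ∈ Γ) {p q r : X} (h : g '' {p, q, r} = {p, q, r}) : g = 1 := by
  have mem : ∀ x ∈ ({p, q, r} : Set X), g x = p ∨ g x = q ∨ g x = r := fun x hx => by
    have : g x ∈ g '' {p, q, r} := ⟨x, hx, rfl⟩
    simpa [h] using this
  by_contra hne
  have n1 : ∀ x, g x ≠ x := fun x hx => hne (hΓ.free g hg x hx)
  have n2 : ∀ x, g (g x) ≠ x := fun x hx => hne (hΓ.free_two g hg x hx)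
  have n3 : ∀ x, g (g (g x)) ≠ x := fun x hx => hne (hΓ.free_three g hg x hx)
  have hp := mem p (by simp)
  have hq := mem q (by simp)
  have hr := mem r (by simp)
  have := n1 p; have := n1 q; have := n1 r
  have := n2 p; have := n2 q; have := n2 r
  have := n3 p
  rcases hp with hp | hp | hp <;> rcases hq with hq | hq | hq <;> rcases hr with hr | hr | hr <;>
    simp_all

/-- The triangulation gives noncollinearity for some enumeration of the vertex set. Collinearity
depends only on the set, so it carries over to the enumeration a, b, c. -/
lemma IsStraightChart.cross_ne_zero (hψ : IsStraightChart ψ)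
    (hF : IsGeometricTriangulation Γ V F) (h : {a, b, c} ∈ F) :
    cross (ψ a) (ψ b) (ψ c) ≠ 0 := by
  obtain ⟨p, q, r, hn, he⟩ := hF.triangle _ h
  rw [hψ.nonCollinear_iff, ne_eq, ← collinear_iff_cross_eq_zero] at hn
  rw [ne_eq, ← collinear_iff_cross_eq_zero]
  have := congrArg (fun s => ψ '' s) he
  simp only [Set.image_insert_eq, Set.image_singleton] at this
  rwa [this]

lemma IsStraightChart.exists_mem_openCell (hψ : IsStraightChart ψ) {s : Set X} {z : ℂ}
    (hz : z ∈ relInt (ψ '' s)) : ∃ x, ψ x = z ∧ x ∈ openCell s := by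
  have h := (mem_relInt.1 hz).1
  rw [← hψ.image_geodHull] at h
  obtain ⟨x, -, rfl⟩ := h
  exact ⟨x, rfl, hψ.mem_openCell.2 hz⟩

lemma mem_simplices_of_mem {t : Set X} (hF : IsGeometricTriangulation Γ V F) (ht : t ∈ F) :
    t ∈ simplices F := by
  refine ⟨?_, t, ht, subset_rfl⟩
  obtain ⟨p, q, r, -, rfl⟩ := hF.triangle t ht
  simp

lemma eq_of_same_side (hψ : IsStraightChart ψ) (hF : IsGeometricTriangulation Γ V F)
    {e : X} (hc : {a, b, c} ∈ F) (he : {a, b, e} ∈ F)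
    (h : 0 < cross (ψ a) (ψ b) (ψ c) * cross (ψ a) (ψ b) (ψ e)) :
    ({a, b, c} : Set X) = {a, b, e} := by
  obtain ⟨z, hz, hz'⟩ := relInt_inter_nonempty h
  obtain ⟨x, rfl, hx⟩ := hψ.exists_mem_openCell (s := {a, b, c}) (z := z) (by
    rwa [Set.image_insert_eq, Set.image_pair])
  exact (hF.partition x).unique ⟨mem_simplices_of_mem hF hc, hx⟩
    ⟨mem_simplices_of_mem hF he, hψ.mem_openCell_triple.2 hz'⟩

/-- A triangulation with two adjacent triangles whose union has crossing diagonals. -/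
structure IsFlippable (ψ : X → ℂ) (Γ : Subgroup (Equiv.Perm X)) (V : Set (Surface Γ))
    (F : Set (Set X)) (a b c d : X) : Prop where
  chart : IsStraightChart ψ
  action : IsOrientedAction ψ Γ
  triangulation : IsGeometricTriangulation Γ V F
  mem_left : {a, b, c} ∈ F
  mem_right : {b, a, d} ∈ F
  crossing : Crossing (ψ a) (ψ b) (ψ c) (ψ d)

/-- A Delaunay flippable edge is a diagonal of a strictly convex quadrilateral. -/
lemma IsDelaunayFlippable.isFlippable [PlaneModel X] (hψ : IsStraightChart ψ)
    (hΓ : IsOrientedAction ψ Γ) (hF : IsGeometricTriangulation Γ V F)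
    (h : IsDelaunayFlippable F a b c d) : IsFlippable ψ Γ V F a b c d := by
  have hmr : {a, b, d} ∈ F := by rw [Set.insert_comm]; exact h.mem_right
  have hc := hψ.cross_ne_zero hF h.mem_left
  have hd := hψ.cross_ne_zero hF hmr
  -- Only nondegeneracy and the inclusion of the open triangle in its disk are kept.
  obtain ⟨D, ⟨hn, _, _, _, _, _, -, -, -, -, -, hD⟩, ha⟩ := h.disk_left
  obtain ⟨D', ⟨hn', _, _, _, _, _, -, -, -, -, -, hD'⟩, hb⟩ := h.disk_right
  refine ⟨hψ, hΓ, hF, h.mem_left, h.mem_right, crossing_of_cross_mul_neg ?_ ?_ ?_ ?_ ?_⟩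
  -- On the same side of ab the two triangles would overlap, hence coincide, which forces c = d.
  · by_contra! hle
    have heq := eq_of_same_side hψ hF h.mem_left hmr (hle.lt_of_ne' (mul_ne_zero hc hd))
    have hmem : c ∈ ({a, b, d} : Set X) := by rw [← heq]; simp
    obtain ⟨-, hbc, hca⟩ := ne_of_cross_ne_zero hc
    rcases hmem with rfl | rfl | rfl
    · exact hca rfl
    · exact hbc rfl
    · exact h.ne rfl
  · rw [cross_swap]
    exact neg_ne_zero.2 (hψ.nonCollinear_iff.1 hn')
  · exact hψ.nonCollinear_iff.1 hn
  · exact fun h' => ha (hD (hψ.mem_openCell_triple.2 h'))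
  · exact fun h' => hb (hD' (hψ.mem_openCell_triple.2 h'))

namespace IsFlippable

variable (h : IsFlippable ψ Γ V F a b c d)
include h

lemma swap : IsFlippable ψ Γ V F b a d c :=
  ⟨h.chart, h.action, h.triangulation, h.mem_right, h.mem_left, h.crossing.swap_left.swap_right⟩

lemma ne_ab : a ≠ b := fun e => (ne_of_cross_ne_zero h.crossing.ne₁).1 (congrArg ψ e)
lemma ne_bc : b ≠ c := fun e => (ne_of_cross_ne_zero h.crossing.ne₁).2.1 (congrArg ψ e)
lemma ne_ca : c ≠ a := fun e => (ne_of_cross_ne_zero h.crossing.ne₁).2.2 (congrArg ψ e)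
lemma ne_bd : b ≠ d := h.swap.ne_ca.symm
lemma ne_da : d ≠ a := h.swap.ne_bc.symm

/-- Without fixed points and without the swap of a and b, only the maps (a, b, c) ↦ (b, d, a) and
(a, b, c) ↦ (d, a, b) remain. Both reverse orientation, since c and d lie on opposite sides of ab.
-/
lemma eq_one_of_image_left_eq_right {g : Equiv.Perm X} (hg : g ∈ Γ)
    (he : g '' {a, b, c} = {b, a, d}) : g = 1 := by
  have mem : ∀ x ∈ ({a, b, c} : Set X), g x = b ∨ g x = a ∨ g x = d := fun x hx => by
    have : g x ∈ g '' {a, b, c} := ⟨x, hx, rfl⟩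
    simpa [he] using this
  by_contra hne
  have n1 : ∀ x, g x ≠ x := fun x hx => hne (h.action.free g hg x hx)
  have n2 : ∀ x, g (g x) ≠ x := fun x hx => hne (h.action.free_two g hg x hx)
  have hab := g.injective.ne h.ne_ab
  have hbc := g.injective.ne h.ne_bc
  have hca := g.injective.ne h.ne_ca
  have key : (g a = b ∧ g b = d ∧ g c = a) ∨ (g a = d ∧ g b = a ∧ g c = b) := by
    have ha := mem a (by simp)
    have hb := mem b (by simp)
    have hc := mem c (by simp)
    have := n1 a; have := n1 b; have := n2 a
    rcases ha with ha | ha | ha <;> rcases hb with hb | hb | hb <;>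
      rcases hc with hc | hc | hc <;> simp_all
  have hpos := h.action.cross_mul_pos hg h.crossing.ne₁
  have hneg := h.crossing.cross_mul_neg
  rcases key with ⟨ha, hb, hc⟩ | ⟨ha, hb, hc⟩
  · rw [ha, hb, hc, ← cross_rotate (ψ b)] at hpos
    rw [← cross_rotate (ψ a) (ψ b) (ψ d), ← cross_rotate (ψ b) (ψ d)] at hneg
    linarith
  · rw [ha, hb, hc] at hpos
    rw [← cross_rotate (ψ d)] at hpos
    linarith

/-- The translates of the cells of the quadrilateral are distinct. -/
lemma eq_one_of_image_eq {g : Equiv.Perm X} (hg : g ∈ Γ) {s t : Set X}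
    (hs : s ∈ quadCells a b c d) (ht : t ∈ quadCells a b c d) (he : g '' s = t) : g = 1 := by
  have hab := h.ne_ab
  have hbc := h.ne_bc
  have hca := h.ne_ca
  have hbd := h.ne_bd
  have hda := h.ne_da
  have card3 : ∀ {p q r : X}, p ≠ q → q ≠ r → r ≠ p → ({p, q, r} : Set X).ncard = 3 :=
    fun h1 h2 h3 => Set.ncard_eq_three.2 ⟨_, _, _, h1, h3.symm, h2, rfl⟩
  have hcard : s.ncard = t.ncard := by rw [← he, Set.ncard_image_of_injective _ g.injective]
  have c1 := card3 hab hbc hca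
  have c2 := card3 hab.symm hda.symm hbd.symm
  have c3 : ({a, b} : Set X).ncard = 2 := Set.ncard_pair hab
  rcases hs with rfl | rfl | rfl <;> rcases ht with rfl | rfl | rfl
  · exact h.action.eq_one_of_image_triple hg he
  · exact h.eq_one_of_image_left_eq_right hg he
  · omega
  · exact h.swap.eq_one_of_image_left_eq_right hg he
  · exact h.action.eq_one_of_image_triple hg he
  · omega
  · omega
  · omega
  · have mem : ∀ x ∈ ({a, b} : Set X), g x = a ∨ g x = b := fun x hx => by
      have : g x ∈ g '' {a, b} := ⟨x, hx, rfl⟩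
      simpa [he] using this
    rcases mem a (by simp) with h1 | h1
    · exact h.action.free g hg a h1
    · rcases mem b (by simp) with h2 | h2
      · exact h.action.free_two g hg a (by rw [h1, h2])
      · exact h.action.free g hg b h2

lemma eq_of_image_eq_image {g g' : Equiv.Perm X} (hg : g ∈ Γ) (hg' : g' ∈ Γ) {s t : Set X}
    (hs : s ∈ quadCells a b c d) (ht : t ∈ quadCells a b c d) (he : g '' s = g' '' t) :
    g = g' := by
  have : g'⁻¹ * g = 1 := h.eq_one_of_image_eq (Γ.mul_mem (Γ.inv_mem hg') hg) hs ht (by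
    rw [image_mul, he, image_inv_image])
  rw [inv_mul_eq_one] at this
  exact this.symm

/-- The two triangles are the only ones that have the edge `a b`. -/
lemma eq_or_eq_of_subset {t : Set X} (ht : t ∈ F) (hab : {a, b} ⊆ t) :
    t = {a, b, c} ∨ t = {b, a, d} := by
  have hmr : {a, b, d} ∈ F := by rw [Set.insert_comm]; exact h.mem_right
  obtain ⟨e, rfl⟩ : ∃ e, t = {a, b, e} := by
    have hne := h.ne_ab
    obtain ⟨p, q, r, -, rfl⟩ := h.triangulation.triangle t ht
    have ha := hab (by simp : a ∈ ({a, b} : Set X))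
    have hb := hab (by simp : b ∈ ({a, b} : Set X))
    rcases ha with rfl | rfl | rfl <;> rcases hb with rfl | rfl | rfl <;>
      first
      | exact absurd rfl hne
      | exact ⟨p, by ext; grind⟩
      | exact ⟨q, by ext; grind⟩
      | exact ⟨r, by ext; grind⟩
  have he := h.chart.cross_ne_zero h.triangulation ht
  have hneg := h.crossing.cross_mul_neg
  -- The third vertex e lies on the side of c or on that of d, and each side of ab carries only one
  -- triangle.
  by_cases hs : 0 < cross (ψ a) (ψ b) (ψ c) * cross (ψ a) (ψ b) (ψ e)
  · exact Or.inl (eq_of_same_side h.chart h.triangulation h.mem_left ht hs).symm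
  · refine Or.inr ?_
    rw [Set.insert_comm b]
    refine (eq_of_same_side h.chart h.triangulation hmr ht ?_).symm
    have h1 := (not_lt.1 hs).lt_of_ne (mul_ne_zero h.crossing.ne₁ he)
    have h2 := mul_pos_of_neg_of_neg hneg h1
    have h3 := mul_self_pos.2 h.crossing.ne₁
    refine pos_of_mul_pos_right (a := cross (ψ a) (ψ b) (ψ c) * cross (ψ a) (ψ b) (ψ c)) ?_ h3.le
    linarith

lemma eq_image_or_eq_image_of_subset {g : Equiv.Perm X} (hg : g ∈ Γ) {t : Set X} (ht : t ∈ F)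
    (hab : g '' {a, b} ⊆ t) : t = g '' {a, b, c} ∨ t = g '' {b, a, d} := by
  have := h.eq_or_eq_of_subset (h.triangulation.invariant _ (Γ.inv_mem hg) t ht) (by
    rw [← image_inv_image g {a, b}]
    exact Set.image_mono hab)
  rcases this with e | e
  · left; rw [← e, image_image_inv]
  · right; rw [← e, image_image_inv]

lemma exchange {s : Set X} (hs : s ∈ quadCells a b c d) {x : X} (hx : x ∈ openCell s) :
    ∃ t ∈ quadCells c d b a, x ∈ openCell t := by
  have hs' : ψ '' s ∈ quadCells (ψ a) (ψ b) (ψ c) (ψ d) := by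
    rw [← image_quadCells]; exact ⟨s, hs, rfl⟩
  obtain ⟨t, ht, hxt⟩ := h.crossing.exchange hs' (h.chart.mem_openCell.1 hx)
  rw [← image_quadCells] at ht
  obtain ⟨t, ht, rfl⟩ := ht
  exact ⟨t, ht, h.chart.mem_openCell.2 hxt⟩

lemma exchange_symm {s : Set X} (hs : s ∈ quadCells c d b a) {x : X} (hx : x ∈ openCell s) :
    ∃ t ∈ quadCells a b c d, x ∈ openCell t := by
  have hs' : ψ '' s ∈ quadCells (ψ c) (ψ d) (ψ b) (ψ a) := by
    rw [← image_quadCells]; exact ⟨s, hs, rfl⟩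
  obtain ⟨t, ht, hxt⟩ := h.crossing.exchange_symm hs' (h.chart.mem_openCell.1 hx)
  rw [← image_quadCells] at ht
  obtain ⟨t, ht, rfl⟩ := ht
  exact ⟨t, ht, h.chart.mem_openCell.2 hxt⟩

lemma openCell_unique {s t : Set X} (hs : s ∈ quadCells c d b a) (ht : t ∈ quadCells c d b a)
    {x : X} (hxs : x ∈ openCell s) (hxt : x ∈ openCell t) : s = t := by
  refine h.chart.injective.image_injective (h.crossing.relInt_unique ?_ ?_
    (h.chart.mem_openCell.1 hxs) (h.chart.mem_openCell.1 hxt))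
  · rw [← image_quadCells]; exact ⟨s, hs, rfl⟩
  · rw [← image_quadCells]; exact ⟨t, ht, rfl⟩

end IsFlippable

end Flips

/-- The pair singled out is the diagonal of the quadrilateral. The other two edges are outer sides,
shared by the old and the new triangles, so the faces contained in them survive a flip. -/
lemma subset_triple_cases {α : Type*} {s : Set α} {p q r : α} (h : s ⊆ {p, q, r}) :
    s = {p, q, r} ∨ s = {p, q} ∨ s ⊆ {p, r} ∨ s ⊆ {q, r} := by
  by_cases hp : p ∈ s
  · by_cases hq : q ∈ s
    · by_cases hr : r ∈ s
      · exact Or.inl (h.antisymm (by simp [Set.insert_subset_iff, *]))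
      · refine Or.inr (Or.inl (Set.Subset.antisymm (fun x hx => ?_)
          (by simp [Set.insert_subset_iff, *])))
        rcases h hx with rfl | rfl | rfl
        · simp
        · simp
        · exact absurd hx hr
    · refine Or.inr (Or.inr (Or.inl fun x hx => ?_))
      rcases h hx with rfl | rfl | rfl
      · simp
      · exact absurd hx hq
      · simp
  · refine Or.inr (Or.inr (Or.inr fun x hx => ?_))
    rcases h hx with rfl | rfl | rfl
    · exact absurd hx hp
    · simp
    · simp

section FlipMembership

variable {X : Type} {Γ : Subgroup (Equiv.Perm X)} {F : Set (Set X)} {a b c d : X}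

lemma image_left_mem_flip {g : Equiv.Perm X} (hg : g ∈ Γ) :
    g '' {c, d, b} ∈ flip Γ F a b c d :=
  Or.inr ⟨g, hg, Or.inl rfl⟩

lemma image_right_mem_flip {g : Equiv.Perm X} (hg : g ∈ Γ) :
    g '' {d, c, a} ∈ flip Γ F a b c d :=
  Or.inr ⟨g, hg, Or.inr rfl⟩

lemma mem_flip_or_eq_image {t : Set X} (ht : t ∈ F) :
    t ∈ flip Γ F a b c d ∨ ∃ g ∈ Γ, t = g '' {a, b, c} ∨ t = g '' {b, a, d} := by
  by_cases h : ∃ g ∈ Γ, t = g '' {a, b, c} ∨ t = g '' {b, a, d}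
  · exact Or.inr h
  · push Not at h
    exact Or.inl (Or.inl ⟨ht, h⟩)

lemma image_mem_simplices_flip {g : Equiv.Perm X} (hg : g ∈ Γ) {t : Set X}
    (ht : t ∈ quadCells c d b a) : g '' t ∈ simplices (flip Γ F a b c d) := by
  rcases ht with rfl | rfl | rfl
  · exact ⟨by simp, _, image_left_mem_flip hg, subset_rfl⟩
  · exact ⟨by simp, _, image_right_mem_flip hg, subset_rfl⟩
  · exact ⟨by simp, _, image_left_mem_flip hg, Set.image_mono (by simp [Set.insert_subset_iff])⟩

/-- The old cells outside the translates of the quadrilateral survive the flip. -/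
lemma mem_simplices_flip {s : Set X} (hs : s ∈ simplices F)
    (hn : ∀ g ∈ Γ, ∀ t ∈ quadCells a b c d, s ≠ g '' t) : s ∈ simplices (flip Γ F a b c d) := by
  obtain ⟨hne, t, ht, hst⟩ := hs
  refine ⟨hne, ?_⟩
  rcases mem_flip_or_eq_image (Γ := Γ) (a := a) (b := b) (c := c) (d := d) ht
      with h' | ⟨g, hg, rfl | rfl⟩
  · exact ⟨t, h', hst⟩
  · obtain ⟨s, hs, rfl⟩ := Set.subset_image_iff.1 hst
    rcases subset_triple_cases hs with rfl | rfl | hs | hs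
    · exact absurd rfl (hn g hg _ (by simp [quadCells]))
    · exact absurd rfl (hn g hg _ (by simp [quadCells]))
    · refine ⟨_, image_right_mem_flip hg, Set.image_mono (hs.trans ?_)⟩
      simp [Set.insert_subset_iff]
    · refine ⟨_, image_left_mem_flip hg, Set.image_mono (hs.trans ?_)⟩
      simp [Set.insert_subset_iff]
  · obtain ⟨s, hs, rfl⟩ := Set.subset_image_iff.1 hst
    rcases subset_triple_cases hs with rfl | rfl | hs | hs
    · exact absurd rfl (hn g hg _ (by simp [quadCells]))
    · exact absurd rfl (hn g hg _ (by simp [quadCells, Set.pair_comm b a]))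
    · refine ⟨_, image_left_mem_flip hg, Set.image_mono (hs.trans ?_)⟩
      simp [Set.insert_subset_iff]
    · refine ⟨_, image_right_mem_flip hg, Set.image_mono (hs.trans ?_)⟩
      simp [Set.insert_subset_iff]

end FlipMembership

/-! ### The flipped family is a geometric triangulation. -/

section FlippedTriangulation

variable {X : Type} [MetricSpace X] {ψ : X → ℂ} {Γ : Subgroup (Equiv.Perm X)}
  {V : Set (Surface Γ)} {F : Set (Set X)} {a b c d : X}

namespace IsFlippable

variable (h : IsFlippable ψ Γ V F a b c d)
include h

/-- A cell on the boundary of the quadrilateral is not a translate of one inside. -/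
lemma image_ne_image_of_subset {g g' : Equiv.Perm X} (hg : g ∈ Γ) (hg' : g' ∈ Γ) {s u t : Set X}
    (hu : u = {a, b, c} ∨ u = {b, a, d}) (hsu : s ⊆ u) (hab : ¬ {a, b} ⊆ s)
    (ht : t ∈ quadCells a b c d) : g '' s ≠ g' '' t := by
  intro he
  have huF : u ∈ F := by
    rcases hu with rfl | rfl
    exacts [h.mem_left, h.mem_right]
  have huQ : u ∈ quadCells a b c d := by
    rcases hu with rfl | rfl <;> simp [quadCells]
  have hsub : {a, b} ⊆ t := by
    rcases ht with rfl | rfl | rfl <;> simp [Set.insert_subset_iff]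
  -- Every cell t contains the diagonal, so the triangle g u has the edge g'{a, b}. It is then a
  -- g'-translate of one of the two triangles, whence g = g' and s = t.
  have h1 : g' '' {a, b} ⊆ g '' u :=
    (Set.image_mono hsub).trans (he ▸ Set.image_mono hsu)
  have hgg : g = g' := by
    rcases h.eq_image_or_eq_image_of_subset hg' (h.triangulation.invariant g hg u huF) h1
      with e | e
    · exact h.eq_of_image_eq_image hg hg' huQ (by simp [quadCells]) e
    · exact h.eq_of_image_eq_image hg hg' huQ (by simp [quadCells]) e
  subst hgg
  rw [g.injective.image_injective he] at hab
  exact hab hsub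

lemma mem_simplices_of_subset {g : Equiv.Perm X} (hg : g ∈ Γ) {s u : Set X}
    (hu : u = {a, b, c} ∨ u = {b, a, d}) (hsu : s ⊆ u) (hs : s.Nonempty) :
    g '' s ∈ simplices F := by
  refine ⟨hs.image _, g '' u, h.triangulation.invariant g hg u ?_, Set.image_mono hsu⟩
  rcases hu with rfl | rfl
  exacts [h.mem_left, h.mem_right]

/-- The cells after the flip. -/
lemma simplices_flip_cases {s : Set X} (hs : s ∈ simplices (flip Γ F a b c d)) :
    (∃ g ∈ Γ, ∃ t ∈ quadCells c d b a, s = g '' t) ∨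
      (s ∈ simplices F ∧ ∀ g ∈ Γ, ∀ t ∈ quadCells a b c d, s ≠ g '' t) := by
  have hab := h.ne_ab
  have hbc := h.ne_bc
  have hca := h.ne_ca
  have hbd := h.ne_bd
  have hda := h.ne_da
  obtain ⟨hne, t, ht, hst⟩ := hs
  rcases ht with ⟨ht, hn⟩ | ⟨g, hg, rfl | rfl⟩
  · refine Or.inr ⟨⟨hne, t, ht, hst⟩, fun g hg u hu he => ?_⟩
    have hsub : g '' {a, b} ⊆ t := by
      refine Set.Subset.trans (Set.image_mono ?_) (he ▸ hst)
      rcases hu with rfl | rfl | rfl <;> simp [Set.insert_subset_iff]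
    rcases h.eq_image_or_eq_image_of_subset hg ht hsub with e | e
    · exact (hn g hg).1 e
    · exact (hn g hg).2 e
  · obtain ⟨s, hs, rfl⟩ := Set.subset_image_iff.1 hst
    have old : ∀ u : Set X, u = {a, b, c} ∨ u = {b, a, d} → s ⊆ u → ¬ {a, b} ⊆ s →
        (g '' s ∈ simplices F ∧ ∀ g' ∈ Γ, ∀ t ∈ quadCells a b c d, g '' s ≠ g' '' t) :=
      fun u hu hsu hab => ⟨h.mem_simplices_of_subset hg hu hsu (Set.image_nonempty.1 hne),
        fun g' hg' t ht => h.image_ne_image_of_subset hg hg' hu hsu hab ht⟩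
    have hnab : ¬ {a, b} ⊆ s := fun h' => by
      have : a = c ∨ a = d ∨ a = b := hs (h' (by simp))
      grind
    rcases subset_triple_cases hs with rfl | rfl | hs | hs
    · exact Or.inl ⟨g, hg, _, by simp [quadCells], rfl⟩
    · exact Or.inl ⟨g, hg, _, by simp [quadCells], rfl⟩
    · exact Or.inr (old _ (Or.inl rfl) (hs.trans (by simp [Set.insert_subset_iff])) hnab)
    · exact Or.inr (old _ (Or.inr rfl) (hs.trans (by simp [Set.insert_subset_iff])) hnab)
  · obtain ⟨s, hs, rfl⟩ := Set.subset_image_iff.1 hst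
    have old : ∀ u : Set X, u = {a, b, c} ∨ u = {b, a, d} → s ⊆ u → ¬ {a, b} ⊆ s →
        (g '' s ∈ simplices F ∧ ∀ g' ∈ Γ, ∀ t ∈ quadCells a b c d, g '' s ≠ g' '' t) :=
      fun u hu hsu hab => ⟨h.mem_simplices_of_subset hg hu hsu (Set.image_nonempty.1 hne),
        fun g' hg' t ht => h.image_ne_image_of_subset hg hg' hu hsu hab ht⟩
    have hnab : ¬ {a, b} ⊆ s := fun h' => by
      have : b = d ∨ b = c ∨ b = a := hs (h' (by simp))
      grind
    rcases subset_triple_cases hs with rfl | rfl | hs | hs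
    · exact Or.inl ⟨g, hg, _, by simp [quadCells], rfl⟩
    · exact Or.inl ⟨g, hg, _, by simp [quadCells, Set.pair_comm d c], rfl⟩
    · exact Or.inr (old _ (Or.inr rfl) (hs.trans (by simp [Set.insert_subset_iff])) hnab)
    · exact Or.inr (old _ (Or.inl rfl) (hs.trans (by simp [Set.insert_subset_iff])) hnab)

lemma image_mem_simplices {g : Equiv.Perm X} (hg : g ∈ Γ) {t : Set X}
    (ht : t ∈ quadCells a b c d) : g '' t ∈ simplices F := by
  rcases ht with rfl | rfl | rfl
  · exact h.mem_simplices_of_subset hg (Or.inl rfl) subset_rfl (by simp)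
  · exact h.mem_simplices_of_subset hg (Or.inr rfl) subset_rfl (by simp)
  · exact h.mem_simplices_of_subset hg (Or.inl rfl) (by simp [Set.insert_subset_iff]) (by simp)

lemma image_exchange {g : Equiv.Perm X} (hg : g ∈ Γ) {s : Set X} (hs : s ∈ quadCells a b c d)
    {x : X} (hx : x ∈ openCell (g '' s)) : ∃ t ∈ quadCells c d b a, x ∈ openCell (g '' t) := by
  have hi := h.action.isometry g hg
  obtain ⟨t, ht, hxt⟩ := h.exchange hs ((inv_apply_mem_openCell hi).2 hx)
  exact ⟨t, ht, (inv_apply_mem_openCell hi).1 hxt⟩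

lemma image_exchange_symm {g : Equiv.Perm X} (hg : g ∈ Γ) {s : Set X}
    (hs : s ∈ quadCells c d b a) {x : X} (hx : x ∈ openCell (g '' s)) :
    ∃ t ∈ quadCells a b c d, x ∈ openCell (g '' t) := by
  have hi := h.action.isometry g hg
  obtain ⟨t, ht, hxt⟩ := h.exchange_symm hs ((inv_apply_mem_openCell hi).2 hx)
  exact ⟨t, ht, (inv_apply_mem_openCell hi).1 hxt⟩

lemma partition_flip (x : X) : ∃! s, s ∈ simplices (flip Γ F a b c d) ∧ x ∈ openCell s := by
  obtain ⟨s, ⟨hs, hxs⟩, huniq⟩ := h.triangulation.partition x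
  by_cases hq : ∃ g ∈ Γ, ∃ t ∈ quadCells a b c d, s = g '' t
  · obtain ⟨g, hg, t, ht, rfl⟩ := hq
    obtain ⟨u, hu, hxu⟩ := h.image_exchange hg ht hxs
    refine ⟨g '' u, ⟨image_mem_simplices_flip hg hu, hxu⟩, ?_⟩
    rintro s' ⟨hs', hxs'⟩
    rcases h.simplices_flip_cases hs' with ⟨g', hg', u', hu', rfl⟩ | ⟨hs', hn⟩
    -- Going back to an old cell at x, uniqueness before the flip identifies the two translates of
    -- the quadrilateral, and `openCell_unique` settles the cell inside it.
    · obtain ⟨t', ht', hxt'⟩ := h.image_exchange_symm hg' hu' hxs'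
      obtain rfl := h.eq_of_image_eq_image hg' hg ht' ht
        (huniq _ ⟨h.image_mem_simplices hg' ht', hxt'⟩)
      have hi := h.action.isometry g' hg'
      rw [h.openCell_unique hu' hu ((inv_apply_mem_openCell hi).2 hxs')
        ((inv_apply_mem_openCell hi).2 hxu)]
    · exact absurd (huniq _ ⟨hs', hxs'⟩) (hn g hg t ht)
  · push Not at hq
    refine ⟨s, ⟨mem_simplices_flip hs hq, hxs⟩, ?_⟩
    rintro s' ⟨hs', hxs'⟩
    rcases h.simplices_flip_cases hs' with ⟨g', hg', u', hu', rfl⟩ | ⟨hs', -⟩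
    · obtain ⟨t', ht', hxt'⟩ := h.image_exchange_symm hg' hu' hxs'
      exact absurd (huniq _ ⟨h.image_mem_simplices hg' ht', hxt'⟩).symm (hq g' hg' t' ht')
    · exact huniq _ ⟨hs', hxs'⟩

lemma sUnion_flip : ⋃₀ flip Γ F a b c d = ⋃₀ F := by
  apply Set.Subset.antisymm
  · rintro x ⟨t, ⟨ht, -⟩ | ⟨g, hg, rfl | rfl⟩, hxt⟩
    · exact ⟨t, ht, hxt⟩
    · have hl := h.triangulation.invariant g hg _ h.mem_left
      have hr := h.triangulation.invariant g hg _ h.mem_right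
      obtain ⟨y, rfl | rfl | rfl, rfl⟩ := hxt
      · exact ⟨_, hl, _, by simp, rfl⟩
      · exact ⟨_, hr, _, by simp, rfl⟩
      · exact ⟨_, hl, _, by simp, rfl⟩
    · have hl := h.triangulation.invariant g hg _ h.mem_left
      have hr := h.triangulation.invariant g hg _ h.mem_right
      obtain ⟨y, rfl | rfl | rfl, rfl⟩ := hxt
      · exact ⟨_, hr, _, by simp, rfl⟩
      · exact ⟨_, hl, _, by simp, rfl⟩
      · exact ⟨_, hl, _, by simp, rfl⟩
  · rintro x ⟨t, ht, hxt⟩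
    rcases mem_flip_or_eq_image (Γ := Γ) (a := a) (b := b) (c := c) (d := d) ht
      with h' | ⟨g, hg, rfl | rfl⟩
    · exact ⟨t, h', hxt⟩
    · obtain ⟨y, rfl | rfl | rfl, rfl⟩ := hxt
      · exact ⟨_, image_right_mem_flip hg, _, by simp, rfl⟩
      · exact ⟨_, image_left_mem_flip hg, _, by simp, rfl⟩
      · exact ⟨_, image_left_mem_flip hg, _, by simp, rfl⟩
    · obtain ⟨y, rfl | rfl | rfl, rfl⟩ := hxt
      · exact ⟨_, image_left_mem_flip hg, _, by simp, rfl⟩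
      · exact ⟨_, image_right_mem_flip hg, _, by simp, rfl⟩
      · exact ⟨_, image_left_mem_flip hg, _, by simp, rfl⟩

lemma invariant_flip {g : Equiv.Perm X} (hg : g ∈ Γ) {t : Set X}
    (ht : t ∈ flip Γ F a b c d) : g '' t ∈ flip Γ F a b c d := by
  rcases ht with ⟨ht, hn⟩ | ⟨k, hk, rfl | rfl⟩
  · refine Or.inl ⟨h.triangulation.invariant g hg t ht, fun k hk => ?_⟩
    have := hn (g⁻¹ * k) (Γ.mul_mem (Γ.inv_mem hg) hk)
    constructor
    · intro e
      apply this.1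
      rw [image_mul, ← e, image_inv_image]
    · intro e
      apply this.2
      rw [image_mul, ← e, image_inv_image]
  · rw [← image_mul]; exact image_left_mem_flip (Γ.mul_mem hg hk)
  · rw [← image_mul]; exact image_right_mem_flip (Γ.mul_mem hg hk)

lemma triangle_flip {t : Set X} (ht : t ∈ flip Γ F a b c d) :
    ∃ p q r, NonCollinear p q r ∧ t = {p, q, r} := by
  rcases ht with ⟨ht, -⟩ | ⟨k, hk, rfl | rfl⟩
  · exact h.triangulation.triangle t ht
  · exact ⟨k c, k d, k b, (h.chart.nonCollinear_iff.2 h.crossing.ne₄).map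
      (h.action.isometry k hk), by simp [Set.image_insert_eq]⟩
  · exact ⟨k d, k c, k a, (h.chart.nonCollinear_iff.2 h.crossing.symm.swap_left.ne₁).map
      (h.action.isometry k hk), by simp [Set.image_insert_eq]⟩

lemma finite_faces_flip : ∃ F₀ ⊆ flip Γ F a b c d, F₀.Finite ∧
    ∀ t ∈ flip Γ F a b c d, ∃ g ∈ Γ, ∃ s ∈ F₀, t = g '' s := by
  obtain ⟨F₀, -, hfin, hF₀⟩ := h.triangulation.finite_faces
  -- Discarding representatives outside the flipped family is harmless: that family is invariant, so
  -- a surviving triangle has a surviving representative.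
  refine ⟨(F₀ ∩ flip Γ F a b c d) ∪ {{c, d, b}, {d, c, a}}, ?_, ?_, ?_⟩
  · refine Set.union_subset Set.inter_subset_right ?_
    rintro t (rfl | rfl)
    · simpa using image_left_mem_flip (F := F) (a := a) (b := b) (c := c) (d := d) Γ.one_mem
    · simpa using image_right_mem_flip (F := F) (a := a) (b := b) (c := c) (d := d) Γ.one_mem
  · exact (hfin.inter_of_left _).union (by simp)
  · intro t ht
    rcases id ht with ⟨htF, -⟩ | ⟨k, hk, rfl | rfl⟩
    · obtain ⟨g, hg, s, hs, rfl⟩ := hF₀ t htF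
      refine ⟨g, hg, s, Or.inl ⟨hs, ?_⟩, rfl⟩
      have := h.invariant_flip (Γ.inv_mem hg) ht
      rwa [image_inv_image] at this
    · exact ⟨k, hk, _, Or.inr (by simp), rfl⟩
    · exact ⟨k, hk, _, Or.inr (by simp), rfl⟩

/-- Flipping a diagonal of a strictly convex quadrilateral gives a geometric triangulation. -/
theorem isGeometricTriangulation_flip : IsGeometricTriangulation Γ V (flip Γ F a b c d) where
  finite_vertices := h.triangulation.finite_vertices
  vertices := by rw [h.sUnion_flip]; exact h.triangulation.vertices
  triangle _ ht := h.triangle_flip ht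
  invariant _ hg _ ht := h.invariant_flip hg ht
  finite_faces := h.finite_faces_flip
  partition := h.partition_flip

end IsFlippable

end FlippedTriangulation

/-! ### The flat torus: the identity chart and translations. -/

section EuclideanPlane

lemma isStraightChart_complex : IsStraightChart (fun z : ℂ => z) where
  injective := fun _ _ h => h
  mem_geodSegment x y z := by
    rw [mem_segment_iff_wbtw, ← dist_add_dist_eq_iff]
    rfl
  convex_range := by
    have : Set.range (fun z : ℂ => z) = Set.univ := Set.range_id
    rw [this]
    exact convex_univ

lemma IsFlatTorus.exists_eq_addRight {Γ : Subgroup (Equiv.Perm ℂ)} (hΓ : IsFlatTorus Γ)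
    {g : Equiv.Perm ℂ} (hg : g ∈ Γ) : ∃ w : ℂ, ∀ z, g z = z + w := by
  obtain ⟨u, v, -, rfl⟩ := hΓ
  induction hg using Subgroup.closure_induction with
  | mem x hx =>
    rcases hx with rfl | rfl
    · exact ⟨u, fun z => rfl⟩
    · exact ⟨v, fun z => rfl⟩
  | one => exact ⟨0, fun z => by simp⟩
  | mul x y _ _ hx hy =>
    obtain ⟨w, hw⟩ := hx
    obtain ⟨w', hw'⟩ := hy
    exact ⟨w' + w, fun z => by rw [Equiv.Perm.mul_apply, hw', hw, add_assoc]⟩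
  | inv x _ hx =>
    obtain ⟨w, hw⟩ := hx
    refine ⟨-w, fun z => x.injective ?_⟩
    rw [perm_apply_inv_self, hw]
    ring

lemma IsFlatTorus.isOrientedAction {Γ : Subgroup (Equiv.Perm ℂ)} (hΓ : IsFlatTorus Γ) :
    IsOrientedAction (fun z : ℂ => z) Γ where
  isometry g hg := by
    obtain ⟨w, hw⟩ := hΓ.exists_eq_addRight hg
    refine Isometry.of_dist_eq fun x y => ?_
    rw [hw, hw, dist_add_right]
  free g hg x hx := by
    obtain ⟨w, hw⟩ := hΓ.exists_eq_addRight hg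
    rw [hw] at hx
    obtain rfl : w = 0 := by linear_combination hx
    ext z; simp [hw]
  free_two g hg x hx := by
    obtain ⟨w, hw⟩ := hΓ.exists_eq_addRight hg
    rw [hw, hw] at hx
    obtain rfl : w = 0 := by linear_combination hx / 2
    ext z; simp [hw]
  free_three g hg x hx := by
    obtain ⟨w, hw⟩ := hΓ.exists_eq_addRight hg
    rw [hw, hw, hw] at hx
    obtain rfl : w = 0 := by linear_combination hx / 3
    ext z; simp [hw]
  orientation g hg x y z h := by
    obtain ⟨w, hw⟩ := hΓ.exists_eq_addRight hg
    simpa [hw, cross] using h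

end EuclideanPlane

/-! ### The hyperbolic plane: the hyperboloid and its projective chart. -/

section HyperbolicPlane

/-- The projective chart of the upper half-plane, onto the region above a parabola. -/
def projectiveChart (z : ℍ) : ℂ :=
  ⟨z.re, z.re ^ 2 + z.im ^ 2⟩

/-- The Lorentzian form on `ℝ³`. -/
noncomputable def lorentz (p q : ℝ × ℝ × ℝ) : ℝ :=
  (p.1 * q.2.2 + p.2.2 * q.1) / 2 - p.2.1 * q.2.1

/-- The point of the hyperboloid model that corresponds to a point of the half-plane. -/
noncomputable def hyperboloid (z : ℍ) : ℝ × ℝ × ℝ :=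
  (1 / z.im, z.re / z.im, (z.re ^ 2 + z.im ^ 2) / z.im)

lemma lorentz_comm (p q : ℝ × ℝ × ℝ) : lorentz p q = lorentz q p := by
  simp only [lorentz]; ring

lemma lorentz_combo (s t : ℝ) (p q r : ℝ × ℝ × ℝ) :
    lorentz r (s • p + t • q) = s * lorentz r p + t * lorentz r q := by
  simp [lorentz]; ring

lemma cosh_dist_eq_lorentz (z w : ℍ) :
    Real.cosh (dist z w) = lorentz (hyperboloid z) (hyperboloid w) := by
  have hz := z.im_ne_zero
  have hw := w.im_ne_zero
  rw [UpperHalfPlane.cosh_dist, Complex.dist_eq, Complex.sq_norm, Complex.normSq_apply]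
  simp only [lorentz, hyperboloid, Complex.sub_re, Complex.sub_im, UpperHalfPlane.coe_re,
    UpperHalfPlane.coe_im]
  field_simp
  ring

lemma lorentz_self (z : ℍ) : lorentz (hyperboloid z) (hyperboloid z) = 1 := by
  rw [← cosh_dist_eq_lorentz, dist_self, Real.cosh_zero]

/-- The orthogonal complement of a point of the hyperboloid is definite. -/
lemma eq_zero_of_lorentz_eq_zero {p : ℝ × ℝ × ℝ} {z : ℍ} (h : lorentz p p = 0)
    (hz : lorentz p (hyperboloid z) = 0) : p = 0 := by
  obtain ⟨p0, p1, p2⟩ := p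
  have hy := z.im_pos
  simp only [lorentz, hyperboloid] at h hz
  have h2 : p2 = 2 * p1 * z.re - p0 * (z.re ^ 2 + z.im ^ 2) := by
    field_simp at hz
    linarith
  subst h2
  have h3 : (p1 - p0 * z.re) ^ 2 + (p0 * z.im) ^ 2 = 0 := by linarith
  have h4 : p0 * z.im = 0 := by nlinarith [sq_nonneg (p1 - p0 * z.re), sq_nonneg (p0 * z.im)]
  obtain rfl : p0 = 0 := by simpa [hy.ne'] using h4
  have h5 : p1 = 0 := by nlinarith
  simp [h5]

/-- The chart is the central projection of the hyperboloid, dividing by the first coordinate 1 / Im.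
Convex combinations in the chart are thus nonnegative combinations on the hyperboloid, with weights
rescaled by heights; the first coordinate gives the total weight 1. -/
lemma projectiveChart_mem_segment_iff (x y z : ℍ) :
    projectiveChart z ∈ segment ℝ (projectiveChart x) (projectiveChart y) ↔
      ∃ s t : ℝ, 0 ≤ s ∧ 0 ≤ t ∧ hyperboloid z = s • hyperboloid x + t • hyperboloid y := by
  have hx := x.im_pos
  have hy := y.im_pos
  have hz := z.im_pos
  constructor
  · rintro ⟨u, v, hu, hv, huv, h⟩
    have h1 := congrArg Complex.re h
    have h2 := congrArg Complex.im h
    simp only [projectiveChart, Complex.add_re, Complex.add_im, Complex.smul_re, Complex.smul_im,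
      smul_eq_mul] at h1 h2
    refine ⟨u * x.im / z.im, v * y.im / z.im, by positivity, by positivity, ?_⟩
    simp only [hyperboloid, Prod.smul_mk, smul_eq_mul, Prod.mk_add_mk, Prod.mk.injEq]
    refine ⟨?_, ?_, ?_⟩
    · field_simp; linarith
    · field_simp; linarith
    · field_simp; linarith
  · rintro ⟨s, t, hs, ht, h⟩
    simp only [hyperboloid, Prod.smul_mk, smul_eq_mul, Prod.mk_add_mk, Prod.mk.injEq] at h
    obtain ⟨h0, h1, h2⟩ := h
    refine ⟨s * z.im / x.im, t * z.im / y.im, by positivity, by positivity, ?_, ?_⟩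
    · field_simp at h0 ⊢
      linarith
    · apply Complex.ext
      · simp only [projectiveChart, Complex.add_re, Complex.smul_re, smul_eq_mul]
        field_simp at h1 ⊢
        linarith
      · simp only [projectiveChart, Complex.add_im, Complex.smul_im, smul_eq_mul]
        field_simp at h2 ⊢
        linarith

/-- Pairing with x gives cosh d(x, z) = s + t cosh d(x, y), and normalisation of z gives s² + t² +
2st cosh d(x, y) = 1. Eliminating s yields the squares of both sides. -/
lemma sinh_dist_eq {x y z : ℍ} {s t : ℝ} (ht : 0 ≤ t)
    (h : hyperboloid z = s • hyperboloid x + t • hyperboloid y) :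
    Real.sinh (dist x z) = t * Real.sinh (dist x y) := by
  have h1 := cosh_dist_eq_lorentz x z
  have h2 := lorentz_self z
  have e : lorentz (hyperboloid z) (hyperboloid z) =
      s ^ 2 + t ^ 2 + 2 * s * t * Real.cosh (dist x y) := by
    conv_lhs => rw [h, lorentz_combo, lorentz_comm _ (hyperboloid x), lorentz_comm _ (hyperboloid y),
      lorentz_combo, lorentz_combo, lorentz_self, lorentz_self, lorentz_comm (hyperboloid y),
      ← cosh_dist_eq_lorentz]
    ring
  rw [h, lorentz_combo, lorentz_self, ← cosh_dist_eq_lorentz] at h1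
  have hs1 : 0 ≤ Real.sinh (dist x z) := Real.sinh_nonneg_iff.2 dist_nonneg
  have hs2 : 0 ≤ Real.sinh (dist x y) := Real.sinh_nonneg_iff.2 dist_nonneg
  rw [← sq_eq_sq₀ hs1 (by positivity), mul_pow, Real.sinh_sq, Real.sinh_sq, h1]
  linear_combination h2 - e

lemma mem_geodSegment_iff_projectiveChart (x y z : ℍ) :
    z ∈ geodSegment x y ↔
      projectiveChart z ∈ segment ℝ (projectiveChart x) (projectiveChart y) := by
  change dist x z + dist z y = dist x y ↔ _
  constructor
  · intro h
    rcases eq_or_ne x y with rfl | hxy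
    · have : dist x z = 0 := by
        rw [dist_self, dist_comm z] at h; linarith
      rw [dist_eq_zero.1 this]
      exact left_mem_segment ℝ _ _
    rw [projectiveChart_mem_segment_iff]
    have hS : 0 < Real.sinh (dist x y) := Real.sinh_pos_iff.2 (dist_pos.2 hxy)
    have hb : Real.sinh (dist z y) = Real.sinh (dist x y) * Real.cosh (dist x z)
        - Real.cosh (dist x y) * Real.sinh (dist x z) := by
      rw [← Real.sinh_sub, ← h]; ring_nf
    have ha : Real.sinh (dist x z) = Real.sinh (dist x y) * Real.cosh (dist z y)
        - Real.cosh (dist x y) * Real.sinh (dist z y) := by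
      rw [← Real.sinh_sub, ← h]; ring_nf
    have hc : Real.sinh (dist x y) = Real.sinh (dist x z) * Real.cosh (dist z y)
        + Real.cosh (dist x z) * Real.sinh (dist z y) := by
      rw [← Real.sinh_add, h]
    have hs1 : 0 ≤ Real.sinh (dist x z) := Real.sinh_nonneg_iff.2 dist_nonneg
    have hs2 : 0 ≤ Real.sinh (dist z y) := Real.sinh_nonneg_iff.2 dist_nonneg
    -- These ratios of hyperbolic sines are the coefficients that parametrise a geodesic on the
    -- hyperboloid.
    obtain ⟨s, hs⟩ : ∃ s, Real.sinh (dist z y) = s * Real.sinh (dist x y) :=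
      ⟨Real.sinh (dist z y) / Real.sinh (dist x y), by field_simp⟩
    obtain ⟨t, ht⟩ : ∃ t, Real.sinh (dist x z) = t * Real.sinh (dist x y) :=
      ⟨Real.sinh (dist x z) / Real.sinh (dist x y), by field_simp⟩
    rw [hs] at hs2
    rw [ht] at hs1
    refine ⟨s, t, nonneg_of_mul_nonneg_left hs2 hS, nonneg_of_mul_nonneg_left hs1 hS, ?_⟩
    rw [hs, ht] at hb ha hc
    have key : ∀ w, lorentz w (hyperboloid z - (s • hyperboloid x + t • hyperboloid y)) =
        lorentz w (hyperboloid z) - (s * lorentz w (hyperboloid x) + t * lorentz w (hyperboloid y)) := by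
      intro w
      rw [← lorentz_combo]
      simp [lorentz]; ring
    have kx : lorentz (hyperboloid x)
        (hyperboloid z - (s • hyperboloid x + t • hyperboloid y)) = 0 := by
      rw [key, lorentz_self, ← cosh_dist_eq_lorentz, ← cosh_dist_eq_lorentz]
      apply mul_left_cancel₀ hS.ne'
      linear_combination -hb
    have ky : lorentz (hyperboloid y)
        (hyperboloid z - (s • hyperboloid x + t • hyperboloid y)) = 0 := by
      rw [key, lorentz_self, ← cosh_dist_eq_lorentz, ← cosh_dist_eq_lorentz, dist_comm y z,
        dist_comm y x]
      apply mul_left_cancel₀ hS.ne'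
      linear_combination -ha
    have kz : lorentz (hyperboloid z)
        (hyperboloid z - (s • hyperboloid x + t • hyperboloid y)) = 0 := by
      rw [key, lorentz_self, ← cosh_dist_eq_lorentz, ← cosh_dist_eq_lorentz, dist_comm z x]
      apply mul_left_cancel₀ hS.ne'
      linear_combination hc
    -- The difference of the two sides is orthogonal to x, y and z, hence to itself; being
    -- orthogonal to a point of the hyperboloid as well, it vanishes.
    refine sub_eq_zero.1 (eq_zero_of_lorentz_eq_zero (z := x) ?_ (by rw [lorentz_comm]; exact kx))
    rw [key, lorentz_comm _ (hyperboloid z), lorentz_comm _ (hyperboloid x),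
      lorentz_comm _ (hyperboloid y), kx, ky, kz]
    ring
  · rw [projectiveChart_mem_segment_iff]
    rintro ⟨s, t, hs, ht, h⟩
    have h' : hyperboloid z = t • hyperboloid y + s • hyperboloid x := by rw [h, add_comm]
    have ha := sinh_dist_eq ht h
    have hb := sinh_dist_eq hs h'
    have hx := cosh_dist_eq_lorentz x z
    have hy := cosh_dist_eq_lorentz y z
    have hz := lorentz_self z
    conv_lhs at hz => rw [h, lorentz_combo, ← h, lorentz_comm (hyperboloid z),
      lorentz_comm (hyperboloid z), ← cosh_dist_eq_lorentz, ← cosh_dist_eq_lorentz]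
    rw [h, lorentz_combo, lorentz_self, ← cosh_dist_eq_lorentz] at hx
    rw [h', lorentz_combo, lorentz_self, ← cosh_dist_eq_lorentz, dist_comm y x] at hy
    rw [dist_comm y x] at hb
    rw [dist_comm z y]
    have hcosh : Real.cosh (dist x z + dist y z) = Real.cosh (dist x y) := by
      rw [Real.cosh_add, ha, hb, hx, hy]
      rw [hx, hy] at hz
      have := Real.sinh_sq (dist x y)
      linear_combination s * t * this + Real.cosh (dist x y) * hz
    exact Real.cosh_strictMonoOn.injOn (add_nonneg dist_nonneg dist_nonneg) dist_nonneg hcosh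

lemma isStraightChart_projectiveChart : IsStraightChart projectiveChart where
  injective z w h := by
    have h1 := congrArg Complex.re h
    have h2 := congrArg Complex.im h
    simp only [projectiveChart] at h1 h2
    rw [h1, add_right_inj, sq_eq_sq₀ z.im_pos.le w.im_pos.le] at h2
    exact UpperHalfPlane.ext_re_im h1 h2
  mem_geodSegment := mem_geodSegment_iff_projectiveChart
  convex_range := by
    have : Set.range projectiveChart = {w : ℂ | w.re ^ 2 < w.im} := by
      ext w
      constructor
      · rintro ⟨z, rfl⟩
        have := z.im_pos
        simp only [projectiveChart, Set.mem_ofPred_eq]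
        nlinarith
      · intro hw
        have hw' : 0 < w.im - w.re ^ 2 := sub_pos.2 hw
        refine ⟨⟨⟨w.re, √(w.im - w.re ^ 2)⟩, Real.sqrt_pos.2 hw'⟩, ?_⟩
        apply Complex.ext
        · rfl
        · change w.re ^ 2 + √(w.im - w.re ^ 2) ^ 2 = w.im
          rw [Real.sq_sqrt hw'.le]; ring
    rw [this]
    intro z hz w hw u v hu hv huv
    simp only [Set.mem_ofPred_eq, Complex.add_re, Complex.add_im, Complex.smul_re, Complex.smul_im,
      smul_eq_mul] at hz hw ⊢
    obtain rfl : u = 1 - v := by linarith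
    -- This is the convexity defect of the square function, whose strict epigraph is the range.
    have h1 : 0 ≤ (1 - v) * v * (z.re - w.re) ^ 2 := by positivity
    rcases hv.eq_or_lt with rfl | hv
    · nlinarith
    · nlinarith

/-! ### Möbius transformations in the projective chart and their fixed points. -/

lemma coe_smul_mul_denom (m : SL(2, ℝ)) (z : ℍ) :
    ((m • z : ℍ) : ℂ) * (m 1 0 * z + m 1 1) = m 0 0 * z + m 0 1 ∧
      ((m 1 0 : ℂ) * z + m 1 1) ≠ 0 := by
  have hne : ((m 1 0 : ℂ) * z + m 1 1) ≠ 0 := UpperHalfPlane.denom_ne_zero m z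
  refine ⟨?_, hne⟩
  rw [UpperHalfPlane.coe_specialLinearGroup_apply]
  exact div_mul_cancel₀ _ hne

/-- In the chart m acts projectively by its symmetric square, with denominator D, the squared norm
of m₁₀z + m₁₁. -/
lemma smul_projectiveChart (m : SL(2, ℝ)) (z : ℍ) : ∃ D : ℝ, 0 < D ∧
    D = m 1 0 ^ 2 * (projectiveChart z).im + 2 * m 1 0 * m 1 1 * (projectiveChart z).re
      + m 1 1 ^ 2 ∧
    D * (projectiveChart (m • z)).re = m 0 0 * m 1 0 * (projectiveChart z).im
      + (m 0 0 * m 1 1 + m 0 1 * m 1 0) * (projectiveChart z).re + m 0 1 * m 1 1 ∧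
    D * (projectiveChart (m • z)).im = m 0 0 ^ 2 * (projectiveChart z).im
      + 2 * m 0 0 * m 0 1 * (projectiveChart z).re + m 0 1 ^ 2 := by
  obtain ⟨h, hne⟩ := coe_smul_mul_denom m z
  have h1 := congrArg Complex.re h
  have h2 := congrArg Complex.im h
  simp only [Complex.mul_re, Complex.mul_im, Complex.add_re, Complex.add_im, Complex.ofReal_re,
    Complex.ofReal_im, UpperHalfPlane.coe_re, UpperHalfPlane.coe_im, zero_mul, sub_zero,
    add_zero] at h1 h2
  have hD := Complex.normSq_pos.2 hne
  rw [Complex.normSq_apply] at hD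
  simp only [Complex.mul_re, Complex.mul_im, Complex.add_re, Complex.add_im, Complex.ofReal_re,
    Complex.ofReal_im, UpperHalfPlane.coe_re, UpperHalfPlane.coe_im, zero_mul, sub_zero,
    add_zero] at hD
  refine ⟨_, hD, ?_, ?_, ?_⟩
  · simp only [projectiveChart]; ring
  · simp only [projectiveChart]
    linear_combination (m 1 0 * z.re + m 1 1) * h1 + m 1 0 * z.im * h2
  · simp only [projectiveChart]
    linear_combination ((m • z).re * (m 1 0 * z.re + m 1 1) - (m • z).im * (m 1 0 * z.im)
      + (m 0 0 * z.re + m 0 1)) * h1 + ((m • z).re * (m 1 0 * z.im)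
      + (m • z).im * (m 1 0 * z.re + m 1 1) + m 0 0 * z.im) * h2

lemma smul_eq_self_iff (m : SL(2, ℝ)) (z : ℍ) :
    m • z = z ↔ (m 0 0 : ℂ) * z + m 0 1 = z * (m 1 0 * z + m 1 1) := by
  obtain ⟨h, hne⟩ := coe_smul_mul_denom m z
  rw [UpperHalfPlane.ext_iff, ← h, mul_left_inj' hne]

lemma det_eq (m : SL(2, ℝ)) : m 0 0 * m 1 1 - m 0 1 * m 1 0 = 1 := by
  have := m.det_coe
  rwa [Matrix.det_fin_two] at this

lemma cross_smul_pos (m : SL(2, ℝ)) {x y z : ℍ}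
    (h : 0 < cross (projectiveChart x) (projectiveChart y) (projectiveChart z)) :
    0 < cross (projectiveChart (m • x)) (projectiveChart (m • y)) (projectiveChart (m • z)) := by
  obtain ⟨D₁, hD₁, e₁, f₁, g₁⟩ := smul_projectiveChart m x
  obtain ⟨D₂, hD₂, e₂, f₂, g₂⟩ := smul_projectiveChart m y
  obtain ⟨D₃, hD₃, e₃, f₃, g₃⟩ := smul_projectiveChart m z
  have hdet := det_eq m
  have key : D₁ * D₂ * D₃ *
      cross (projectiveChart (m • x)) (projectiveChart (m • y)) (projectiveChart (m • z)) =
      cross (projectiveChart x) (projectiveChart y) (projectiveChart z) := by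
    have expand : D₁ * D₂ * D₃ *
        cross (projectiveChart (m • x)) (projectiveChart (m • y)) (projectiveChart (m • z)) =
        D₁ * ((D₂ * (projectiveChart (m • y)).re) * (D₃ * (projectiveChart (m • z)).im)
          - (D₃ * (projectiveChart (m • z)).re) * (D₂ * (projectiveChart (m • y)).im))
        + D₂ * ((D₃ * (projectiveChart (m • z)).re) * (D₁ * (projectiveChart (m • x)).im)
          - (D₁ * (projectiveChart (m • x)).re) * (D₃ * (projectiveChart (m • z)).im))
        + D₃ * ((D₁ * (projectiveChart (m • x)).re) * (D₂ * (projectiveChart (m • y)).im)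
          - (D₂ * (projectiveChart (m • y)).re) * (D₁ * (projectiveChart (m • x)).im)) := by
      simp only [cross]; ring
    rw [expand, f₁, f₂, f₃, g₁, g₂, g₃, e₁, e₂, e₃]
    -- The symmetric square of m has determinant (det m)³ = 1.
    trans (m 0 0 * m 1 1 - m 0 1 * m 1 0) ^ 3 *
      cross (projectiveChart x) (projectiveChart y) (projectiveChart z)
    · simp only [cross]; ring
    · rw [hdet]; ring
  rw [← key] at h
  exact pos_of_mul_pos_right h (by positivity)

/-- The fixed-point equation is quadratic with discriminant trace² - 4, here negative. The absolute
value of m₁₀ selects the root in the upper half-plane; if m₁₀ were 0, the determinant would force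
trace² ≥ 4. -/
lemma exists_fixed_point_of_trace_sq_lt (m : SL(2, ℝ)) (h : (m 0 0 + m 1 1) ^ 2 < 4) :
    ∃ z : ℍ, m • z = z := by
  have hdet := det_eq m
  have hr : m 1 0 ≠ 0 := by
    intro h0
    rw [h0] at hdet
    nlinarith [sq_nonneg (m 0 0 - m 1 1)]
  have hpos : 0 < 4 - (m 0 0 + m 1 1) ^ 2 := by linarith
  have hy : 0 < √(4 - (m 0 0 + m 1 1) ^ 2) / (2 * |m 1 0|) := by positivity
  refine ⟨⟨⟨(m 0 0 - m 1 1) / (2 * m 1 0), _⟩, hy⟩, ?_⟩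
  rw [smul_eq_self_iff]
  have hsq : (√(4 - (m 0 0 + m 1 1) ^ 2) / (2 * |m 1 0|)) ^ 2 =
      (4 - (m 0 0 + m 1 1) ^ 2) / (4 * m 1 0 ^ 2) := by
    rw [div_pow, mul_pow, Real.sq_sqrt hpos.le, sq_abs]; norm_num
  generalize √(4 - (m 0 0 + m 1 1) ^ 2) / (2 * |m 1 0|) = y at *
  have hx : 2 * m 1 0 * ((m 0 0 - m 1 1) / (2 * m 1 0)) = m 0 0 - m 1 1 := by field_simp
  have hsq' : 4 * m 1 0 ^ 2 * y ^ 2 = 4 - (m 0 0 + m 1 1) ^ 2 := by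
    rw [hsq]; field_simp
  generalize (m 0 0 - m 1 1) / (2 * m 1 0) = x at *
  apply Complex.ext
  · simp
    apply mul_left_cancel₀ (mul_ne_zero four_ne_zero hr)
    linear_combination hsq' - 4 * hdet - (2 * m 1 0 * x - (m 0 0 - m 1 1)) * hx
  · simp
    linear_combination -y * hx

/-- By Cayley–Hamilton m² = (tr m) m - 1, so the fixed-point equation of m² is tr m ≠ 0 times that
of m. -/
lemma smul_eq_self_of_smul_smul (m : SL(2, ℝ)) {z : ℍ} (ht : 4 ≤ (m 0 0 + m 1 1) ^ 2)
    (h : m • m • z = z) : m • z = z := by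
  rw [smul_smul, smul_eq_self_iff] at h
  rw [smul_eq_self_iff]
  have ht0 : (m 0 0 + m 1 1 : ℂ) ≠ 0 := by
    have : m 0 0 + m 1 1 ≠ 0 := by rintro h0; norm_num [h0] at ht
    exact_mod_cast this
  apply mul_left_cancel₀ ht0
  simp only [Matrix.SpecialLinearGroup.coe_mul, Matrix.mul_apply, Fin.sum_univ_two,
    Complex.ofReal_add, Complex.ofReal_mul] at h
  linear_combination h

/-- Likewise m³ = ((tr m)² - 1) m - tr m, and the coefficient of m is nonzero. -/
lemma smul_eq_self_of_smul_smul_smul (m : SL(2, ℝ)) {z : ℍ} (ht : 4 ≤ (m 0 0 + m 1 1) ^ 2)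
    (h : m • m • m • z = z) : m • z = z := by
  have hdet := congrArg (fun x : ℝ => (x : ℂ)) (det_eq m)
  rw [smul_smul, smul_smul, smul_eq_self_iff] at h
  rw [smul_eq_self_iff]
  have ht0 : ((m 0 0 + m 1 1) ^ 2 - 1 : ℂ) ≠ 0 := by
    have : (m 0 0 + m 1 1) ^ 2 - 1 ≠ 0 := by linarith
    exact_mod_cast this
  apply mul_left_cancel₀ ht0
  simp only [Matrix.SpecialLinearGroup.coe_mul, Matrix.mul_apply, Fin.sum_univ_two,
    Complex.ofReal_add, Complex.ofReal_mul, Complex.ofReal_sub, Complex.ofReal_one] at h hdet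
  linear_combination h + (m 0 0 * z + m 0 1 - z * (m 1 0 * z + m 1 1)) * hdet

lemma IsClosedHyperbolicSurface.isOrientedAction {Γ : Subgroup (Equiv.Perm ℍ)}
    (hΓ : IsClosedHyperbolicSurface Γ) : IsOrientedAction projectiveChart Γ := by
  have lift : ∀ g ∈ Γ, ∃ m : SL(2, ℝ), ∀ z, g z = m • z := fun g hg => by
    obtain ⟨m, rfl⟩ := hΓ.orientation_preserving_isometries hg
    exact ⟨m, fun z => rfl⟩
  refine ⟨fun g hg => ?_, fun g hg x hx => hΓ.free g hg ⟨x, hx⟩, fun g hg x hx => ?_,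
    fun g hg x hx => ?_, fun g hg x y z h => ?_⟩ <;> obtain ⟨m, hm⟩ := lift g hg
  · refine Isometry.of_dist_eq fun x y => ?_
    rw [hm, hm, dist_smul]
  · rcases lt_or_ge ((m 0 0 + m 1 1) ^ 2) 4 with h | h
    · obtain ⟨z, hz⟩ := exists_fixed_point_of_trace_sq_lt m h
      exact hΓ.free g hg ⟨z, by rw [hm, hz]⟩
    · rw [hm, hm] at hx
      exact hΓ.free g hg ⟨x, by rw [hm, smul_eq_self_of_smul_smul m h hx]⟩
  · rcases lt_or_ge ((m 0 0 + m 1 1) ^ 2) 4 with h | h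
    · obtain ⟨z, hz⟩ := exists_fixed_point_of_trace_sq_lt m h
      exact hΓ.free g hg ⟨z, by rw [hm, hz]⟩
    · rw [hm, hm, hm] at hx
      exact hΓ.free g hg ⟨x, by rw [hm, smul_eq_self_of_smul_smul_smul m h hx]⟩
  · rw [hm, hm, hm]
    exact cross_smul_pos m h

end HyperbolicPlane

end GeomTri

theorem mainTheorem9 :
    (∀ Γ : Subgroup (Equiv.Perm ℂ), GeomTri.IsFlatTorus Γ →
      ∀ (V : Set (GeomTri.Surface Γ)) (F : Set (Set ℂ)),
        GeomTri.IsGeometricTriangulation Γ V F →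
      ∀ a b c d : ℂ, GeomTri.IsDelaunayFlippable F a b c d →
        GeomTri.IsGeometricTriangulation Γ V (GeomTri.flip Γ F a b c d) ∧
        GeomTri.StrictlyConvexQuad a b c d) ∧
    (∀ Γ : Subgroup (Equiv.Perm ℍ), GeomTri.IsClosedHyperbolicSurface Γ →
      ∀ (V : Set (GeomTri.Surface Γ)) (F : Set (Set ℍ)),
        GeomTri.IsGeometricTriangulation Γ V F →
      ∀ a b c d : ℍ, GeomTri.IsDelaunayFlippable F a b c d →
        GeomTri.IsGeometricTriangulation Γ V (GeomTri.flip Γ F a b c d) ∧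
        GeomTri.StrictlyConvexQuad a b c d) := by
  refine ⟨fun Γ hΓ V F hF a b c d h => ?_, fun Γ hΓ V F hF a b c d h => ?_⟩
  · have hf := h.isFlippable GeomTri.isStraightChart_complex hΓ.isOrientedAction hF
    exact ⟨hf.isGeometricTriangulation_flip, hf.chart.strictlyConvexQuad hf.crossing⟩
  · have hf := h.isFlippable GeomTri.isStraightChart_projectiveChart hΓ.isOrientedAction hF
    exact ⟨hf.isGeometricTriangulation_flip, hf.chart.strictlyConvexQuad hf.crossing⟩
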